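/- Let $M$ be a smooth Riemannian manifold without boundary of dimension $n\ge 1$, with Levi-Civita connection $\nabla$ and unit sphere bundle $\mathbb{S}M=\{(x,v): x\in M,\ v\in T_xM,\ |v|=1\}$. For $w=(x,v)\in\mathbb{S}M$ use the splitting $T_w\mathbb{S}M=T_xM\oplus T_v\mathbb{S}_xM$ into horizontal and vertical parts given by $\nabla$, where $T_v\mathbb{S}_xM=\{u\in T_xM:\langle v,u\rangle=0\}$. For a linear map $A:T_xM\to T_xM$ let $V_A(v)=Av-\langle v,Av\rangle v$ for $v \in \mathbb{S}_xM$. The lift of a smooth vector field $X$ on $M$ is the vector field $\tilde X(x,v)=(X(x),V_{\nabla X(x)}(v))$ on $\mathbb{S}M$. For vector fields $Z_0,Z_1,\dots,Z_r$ on a manifold $\mathcal M$ put $\mathscr X_0=\{Z_j:j\ge1\}$ and $\mathscr X_{k+1}=\mathscr X_k\cup\{[Z_j,Z]:Z\in\mathscr X_k,\ j\ge0\}$, and let $\mathrm{Lie}(Z_0;Z_1,\dots,Z_r)$ be the real linear span of $\bigcup_{k}\mathscr X_k$. We say that $\{Z_j\}_{j=0}^r$ satisfies the parabolic Hörmander condition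 on $\mathcal M$ if $\{Z(w):Z\in\mathrm{Lie}(Z_0;Z_1,\dots,Z_r)\}=T_w\mathcal M$ for every $w\in\mathcal M$. Let $X_0,X_1,\dots,X_r$ be smooth vector fields on $M$. For $x\in M$ let $$\mathfrak m_x=\Big\{\nabla X(x)-\tfrac1n(\operatorname{div}X)(x)\,\mathrm{Id}\ :\ X\in\mathrm{Lie}(X_0;X_1,\dots,X_r),\ X(x)=0\Big\}.$$ Then the lifts $\{\tilde X_k\}_{k=0}^r$ satisfy the parabolic Hörmander condition on $\mathbb{S}M$ if and only if $\{X_k\}_{k=0}^r$ satisfies the parabolic Hörmander condition on $M$ and, for every $(x,v)\in\mathbb{S}M$, $$\{V_A(v):A\in\mathfrak m_x\}=T_v\mathbb{S}_xM.$$ -/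

import Mathlib

open Bundle Manifold ContDiff FiberBundle VectorField Set

namespace ProjSpan

set_option linter.unusedSectionVars false
set_option linter.unusedSimpArgs false
set_option linter.style.haveILetI false

/-! ### The Levi-Civita connection and the splitting of the tangent bundle of the tangent bundle -/

section LeviCivita

variable {E : Type*} [NormedAddCommGroup E] [NormedSpace ℝ E] [FiniteDimensional ℝ E]
  {H : Type*} [TopologicalSpace H] {I : ModelWithCorners ℝ E H}
  {M : Type*} [TopologicalSpace M] [ChartedSpace H M] [IsManifold I ∞ M]
  [RiemannianBundle (fun x : M => TangentSpace I x)]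
  [IsContMDiffRiemannianBundle I ∞ E (fun x : M => TangentSpace I x)]

theorem mdiffAt_inner {X Y : (x : M) → TangentSpace I x} {x : M}
    (hX : MDiffAt (T% X) x) (hY : MDiffAt (T% Y) x) :
    MDiffAt (fun y => inner ℝ (X y) (Y y)) x :=
  MDifferentiableAt.inner_bundle (E := fun x : M => TangentSpace I x) (b := fun y => y) hX hY

/-- Half of the right-hand side of the Koszul formula, i.e. the value that `⟨∇_Y X, Z⟩` must have at
`x` for the Levi-Civita connection `∇`. -/
noncomputable def koszul (I : ModelWithCorners ℝ E H) {M : Type*} [TopologicalSpace M]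
    [ChartedSpace H M]
    [RiemannianBundle (fun x : M => TangentSpace I x)]
    (X Y Z : (x : M) → TangentSpace I x) (x : M) : ℝ :=
  (1 / 2) * (mvfderiv I (fun y => inner ℝ (X y) (Z y)) x (Y x)
    + mvfderiv I (fun y => inner ℝ (Y y) (Z y)) x (X x)
    - mvfderiv I (fun y => inner ℝ (Y y) (X y)) x (Z x)
    + inner ℝ (mlieBracket I Y X x) (Z x)
    - inner ℝ (mlieBracket I Y Z x) (X x)
    - inner ℝ (mlieBracket I X Z x) (Y x))

theorem koszul_tensorial_left {X Z : (x : M) → TangentSpace I x} {x : M}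
    (hX : MDiffAt (T% X) x) (hZ : MDiffAt (T% Z) x) :
    TensorialAt I E (fun Y => koszul I X Y Z x) x where
  smul {f Y} hf hY := by
    have e1 : (fun y => inner ℝ ((f • Y) y) (Z y)) = fun y => f y * inner ℝ (Y y) (Z y) := by
      ext y; simp [inner_smul_left]
    have e2 : (fun y => inner ℝ ((f • Y) y) (X y)) = fun y => f y * inner ℝ (Y y) (X y) := by
      ext y; simp [inner_smul_left]
    simp only [koszul, e1, e2]
    simp [mvfderiv_fun_mul hf (mdiffAt_inner hY hZ), mvfderiv_fun_mul hf (mdiffAt_inner hY hX),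
      mlieBracket_smul_left hf hY, inner_add_left, inner_smul_left, inner_smul_right]
    ring
  add {Y Y'} hY hY' := by
    simp only [koszul, Pi.add_apply, inner_add_left, inner_add_right]
    rw [mvfderiv_fun_add (mdiffAt_inner hY hZ) (mdiffAt_inner hY' hZ),
      mvfderiv_fun_add (mdiffAt_inner hY hX) (mdiffAt_inner hY' hX),
      mlieBracket_add_left hY hY', mlieBracket_add_left hY hY']
    simp [inner_add_left]
    ring

theorem koszul_tensorial_right {X Y : (x : M) → TangentSpace I x} {x : M}
    (hX : MDiffAt (T% X) x) (hY : MDiffAt (T% Y) x) :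
    TensorialAt I E (fun Z => koszul I X Y Z x) x where
  smul {f Z} hf hZ := by
    have e1 : (fun y => inner ℝ (X y) ((f • Z) y)) = fun y => f y * inner ℝ (X y) (Z y) := by
      ext y; simp [inner_smul_right]
    have e2 : (fun y => inner ℝ (Y y) ((f • Z) y)) = fun y => f y * inner ℝ (Y y) (Z y) := by
      ext y; simp [inner_smul_right]
    simp only [koszul, e1, e2]
    simp [mvfderiv_fun_mul hf (mdiffAt_inner hX hZ), mvfderiv_fun_mul hf (mdiffAt_inner hY hZ),
      mlieBracket_smul_right hf hZ, inner_add_left, inner_smul_left, inner_smul_right]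
    have := real_inner_comm (Z x) (Y x)
    have := real_inner_comm (Z x) (X x)
    simp only [*]
    ring
  add {Z Z'} hZ hZ' := by
    simp only [koszul, Pi.add_apply, inner_add_left, inner_add_right]
    rw [mvfderiv_fun_add (mdiffAt_inner hX hZ) (mdiffAt_inner hX hZ'),
      mvfderiv_fun_add (mdiffAt_inner hY hZ) (mdiffAt_inner hY hZ'),
      mlieBracket_add_right hZ hZ', mlieBracket_add_right hZ hZ']
    simp [inner_add_left]
    ring

theorem koszul_add {X X' Y Z : (x : M) → TangentSpace I x} {x : M}
    (hX : MDiffAt (T% X) x) (hX' : MDiffAt (T% X') x) (hY : MDiffAt (T% Y) x)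
    (hZ : MDiffAt (T% Z) x) :
    koszul I (X + X') Y Z x = koszul I X Y Z x + koszul I X' Y Z x := by
  simp only [koszul, Pi.add_apply, inner_add_left, inner_add_right]
  rw [mvfderiv_fun_add (mdiffAt_inner hX hZ) (mdiffAt_inner hX' hZ),
      mvfderiv_fun_add (mdiffAt_inner hY hX) (mdiffAt_inner hY hX'),
      mlieBracket_add_right hX hX', mlieBracket_add_left hX hX']
  simp [inner_add_left]
  ring

theorem koszul_smul {X Y Z : (x : M) → TangentSpace I x} {f : M → ℝ} {x : M}
    (hX : MDiffAt (T% X) x) (hf : MDiffAt f x) (hY : MDiffAt (T% Y) x)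
    (hZ : MDiffAt (T% Z) x) :
    koszul I (f • X) Y Z x = f x * koszul I X Y Z x + mvfderiv I f x (Y x) * inner ℝ (X x) (Z x) := by
  have e1 : (fun y => inner ℝ ((f • X) y) (Z y)) = fun y => f y * inner ℝ (X y) (Z y) := by
    ext y; simp [inner_smul_left]
  have e2 : (fun y => inner ℝ (Y y) ((f • X) y)) = fun y => f y * inner ℝ (Y y) (X y) := by
    ext y; simp [inner_smul_right]
  simp only [koszul, e1, e2]
  simp [mvfderiv_fun_mul hf (mdiffAt_inner hX hZ), mvfderiv_fun_mul hf (mdiffAt_inner hY hX),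
      mlieBracket_smul_right hf hX, mlieBracket_smul_left hf hX, inner_add_left, inner_smul_left, inner_smul_right]
  have := real_inner_comm (X x) (Y x)
  simp only [*]
  ring

open Classical in
/-- The bilinear form `(y, z) ↦ ⟨∇_y X, z⟩` on `T_x M` given by the Koszul formula (it is set to `0`
if `X` is not differentiable at `x`). -/
noncomputable def koszulForm (X : (x : M) → TangentSpace I x) (x : M) :
    TangentSpace I x →L[ℝ] TangentSpace I x →L[ℝ] ℝ :=
  if hX : MDiffAt (T% X) x then
    TensorialAt.mkHom₂ (I := I) (F := E) (F' := E) (fun Y Z => koszul I X Y Z x) x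
      (fun _ hZ => koszul_tensorial_left hX hZ) (fun _ hY => koszul_tensorial_right hX hY)
  else 0


theorem koszulForm_apply {X Y Z : (x : M) → TangentSpace I x} {x : M}
    (hX : MDiffAt (T% X) x) (hY : MDiffAt (T% Y) x) (hZ : MDiffAt (T% Z) x) :
    koszulForm X x (Y x) (Z x) = koszul I X Y Z x := by
  rw [koszulForm, dif_pos hX]
  exact TensorialAt.mkHom₂_apply _ _ hY hZ

/-- `nabla X x : T_x M → T_x M` is `y ↦ ∇_y X`, obtained from the Koszul form by Riesz duality. -/
noncomputable def nabla (X : (x : M) → TangentSpace I x) (x : M) :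
    TangentSpace I x →L[ℝ] TangentSpace I x :=
  haveI : FiniteDimensional ℝ (TangentSpace I x) := inferInstanceAs (FiniteDimensional ℝ E)
  haveI : CompleteSpace (TangentSpace I x) := FiniteDimensional.complete ℝ _
  LinearMap.toContinuousLinearMap
    { toFun := fun y => (InnerProductSpace.toDual ℝ (TangentSpace I x)).symm (koszulForm X x y)
      map_add' := by simp
      map_smul' := by simp }

theorem inner_nabla (X : (x : M) → TangentSpace I x) (x : M) (y z : TangentSpace I x) :
    inner ℝ (nabla X x y) z = koszulForm X x y z := by
  haveI : FiniteDimensional ℝ (TangentSpace I x) := inferInstanceAs (FiniteDimensional ℝ E)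
  haveI : CompleteSpace (TangentSpace I x) := FiniteDimensional.complete ℝ _
  simp [nabla]

theorem inner_nabla_apply {X Y Z : (x : M) → TangentSpace I x} {x : M}
    (hX : MDiffAt (T% X) x) (hY : MDiffAt (T% Y) x) (hZ : MDiffAt (T% Z) x) :
    inner ℝ (nabla X x (Y x)) (Z x) = koszul I X Y Z x := by
  rw [inner_nabla, koszulForm_apply hX hY hZ]

/-- The Levi-Civita connection; `leviCivita I M X x y` is `∇_y X` at `x`. -/
noncomputable def leviCivita (I : ModelWithCorners ℝ E H) (M : Type*)
    [TopologicalSpace M] [ChartedSpace H M] [IsManifold I ∞ M]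
    [RiemannianBundle (fun x : M => TangentSpace I x)]
    [IsContMDiffRiemannianBundle I ∞ E (fun x : M => TangentSpace I x)] :
    CovariantDerivative I E (fun x : M => TangentSpace I x) where
  toFun := nabla
  isCovariantDerivativeOnUniv :=
    { add := by
        intro X X' x hX hX' _
        ext1 y
        refine ext_inner_right ℝ fun z => ?_
        have hy := mdifferentiableAt_extend I E y
        have hz := mdifferentiableAt_extend I E z
        have h1 := inner_nabla_apply (mdifferentiableAt_add_section hX hX') hy hz
        have h2 := inner_nabla_apply hX hy hz
        have h3 := inner_nabla_apply hX' hy hz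
        simp only [extend_apply_self] at h1 h2 h3
        rw [add_apply, inner_add_left, h1, h2, h3, koszul_add hX hX' hy hz]
      leibniz := by
        intro X f x hX hf _
        ext1 y
        refine ext_inner_right ℝ fun z => ?_
        have hy := mdifferentiableAt_extend I E y
        have hz := mdifferentiableAt_extend I E z
        have h1 := inner_nabla_apply (hf.smul_section hX) hy hz
        have h2 := inner_nabla_apply hX hy hz
        simp only [extend_apply_self] at h1 h2
        rw [h1, koszul_smul hX hf hy hz]
        simp [inner_add_left, inner_smul_left, h2] }

/-- The Levi-Civita connection is torsion free. -/
theorem leviCivita_torsion : (leviCivita I M).torsion = 0 := by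
  rw [CovariantDerivative.torsion_eq_zero_iff]
  intro X Y x hX hY
  refine ext_inner_right ℝ fun z => ?_
  have hz := mdifferentiableAt_extend I E z
  have h1 := inner_nabla_apply hX hY hz
  have h2 := inner_nabla_apply hY hX hz
  simp only [extend_apply_self] at h1 h2
  change inner ℝ (nabla Y x (X x) - nabla X x (Y x)) z = _
  rw [inner_sub_left, h1, h2, koszul, koszul, mlieBracket_swap_apply (V := Y) (W := X)]
  have e (y : M) := real_inner_comm (Y y) (X y)
  simp only [e, extend_apply_self, inner_neg_left]
  ring

/-- The Levi-Civita connection is compatible with the metric. -/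
theorem leviCivita_metric {X Y Z : (x : M) → TangentSpace I x} {x : M}
    (hX : MDiffAt (T% X) x) (hY : MDiffAt (T% Y) x) (hZ : MDiffAt (T% Z) x) :
    mvfderiv I (fun y => inner ℝ (Y y) (Z y)) x (X x) =
      inner ℝ (leviCivita I M Y x (X x)) (Z x) + inner ℝ (Y x) (leviCivita I M Z x (X x)) := by
  have h1 := inner_nabla_apply hY hX hZ
  have h2 := inner_nabla_apply hZ hX hY
  have e := real_inner_comm (nabla Z x (X x)) (Y x)
  change _ = inner ℝ (nabla Y x (X x)) (Z x) + inner ℝ (Y x) (nabla Z x (X x))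
  rw [e, h1, h2, koszul, koszul, mlieBracket_swap_apply (V := Z) (W := Y)]
  have e1 (y : M) := real_inner_comm (Y y) (X y)
  have e2 (y : M) := real_inner_comm (Z y) (X y)
  have e3 (y : M) := real_inner_comm (Z y) (Y y)
  simp only [e1, e2, e3, inner_neg_left]
  ring

/-- The vertical lift of `u ∈ T_x M` to `T_p (TM)`, `p = (x, v)`: the velocity at `t = 0` of the curve
`t ↦ (x, v + t u)` in the fibre. -/
noncomputable def verticalLift (p : TangentBundle I M) (u : TangentSpace I p.1) :
    TangentSpace I.tangent p :=
  mfderiv 𝓘(ℝ, ℝ) I.tangent (fun t : ℝ => (⟨p.1, p.2 + t • u⟩ : TangentBundle I M)) 0 (1 : ℝ)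

/-- The horizontal lift of `y ∈ T_x M` to `T_p (TM)`, `p = (x, v)`: for any local vector field `σ`
with `σ x = v` it is `dσ_x(y)` minus the vertical lift of `∇_y σ`. Here `σ` is the extension of `v`
that is constant in the trivialization of `TM` at `x`. -/
noncomputable def horizontalLift (p : TangentBundle I M) (y : TangentSpace I p.1) :
    TangentSpace I.tangent p :=
  let D : TangentSpace I.tangent p :=
    mfderiv I I.tangent (fun x : M => (⟨x, extend E p.2 x⟩ : TangentBundle I M)) p.1 y
  D - verticalLift p (leviCivita I M (extend E p.2) p.1 y)

/-- The divergence `div X = tr ∇X`. -/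
noncomputable def divergence (X : (x : M) → TangentSpace I x) (x : M) : ℝ :=
  LinearMap.trace ℝ (TangentSpace I x) (leviCivita I M X x).toLinearMap

/-- The traceless operator `M_X(x) = ∇X(x) - (1/n) (div X)(x) Id` on `T_x M`, `n = dim M`. -/
noncomputable def tracelessPart (X : (x : M) → TangentSpace I x) (x : M) :
    TangentSpace I x →L[ℝ] TangentSpace I x :=
  leviCivita I M X x
    - ((1 / (Module.finrank ℝ E : ℝ)) * divergence X x) • ContinuousLinearMap.id ℝ (TangentSpace I x)

end LeviCivita

/-! ### The unit sphere bundle -/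

section SphereBundle
variable {d : ℕ} {M : Type*} [TopologicalSpace M] [ChartedSpace (EuclideanSpace ℝ (Fin (d + 1))) M]
  [RiemannianBundle (fun x : M => TangentSpace (𝓡 (d + 1)) x)]

variable (d M) in
/-- The unit sphere bundle `SM = {(x, v) ∈ TM : |v| = 1}` of a Riemannian manifold of dimension
`d + 1`. -/
def SphereBundle : Type _ := {p : TangentBundle (𝓡 (d + 1)) M // ‖p.2‖ = 1}

variable [IsManifold (𝓡 (d + 1)) ∞ M] 
instance : TopologicalSpace (SphereBundle d M) :=
  inferInstanceAs (TopologicalSpace {p : TangentBundle (𝓡 (d + 1)) M // ‖p.2‖ = 1})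

/-- The unit sphere of the model space, on which the fibres of `SM` are modelled. -/
abbrev fibSphere (d : ℕ) := Metric.sphere (0 : EuclideanSpace ℝ (Fin (d + 1))) 1

open Classical in
/-- `u ↦ u / |u|` (with an arbitrary value at `0`). -/
noncomputable def toSphere (u : EuclideanSpace ℝ (Fin (d + 1))) : fibSphere d :=
  if h : u = 0 then ⟨EuclideanSpace.single 0 1, by simp⟩ else ⟨‖u‖⁻¹ • u, by simp [norm_smul, h]⟩

open Classical in
/-- The radial retraction `(x, v) ↦ (x, v / |v|)` of `TM` minus the zero section onto `SM` (with the
value `w` on the zero section, where it is irrelevant). -/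
noncomputable def radial (w : SphereBundle d M) (p : TangentBundle (𝓡 (d + 1)) M) :
    SphereBundle d M :=
  if h : p.2 = 0 then w else ⟨⟨p.1, ‖p.2‖⁻¹ • p.2⟩, by simp [norm_smul, h]⟩

theorem coe_toSphere {u : EuclideanSpace ℝ (Fin (d + 1))} (h : u ≠ 0) :
  (toSphere u : EuclideanSpace ℝ (Fin (d + 1))) = ‖u‖⁻¹ • u := by simp [toSphere, h]

theorem coe_radial (w : SphereBundle d M) {p : TangentBundle (𝓡 (d + 1)) M} (h : p.2 ≠ 0) :
   (radial w p).1 = ⟨p.1, ‖p.2‖⁻¹ • p.2⟩ := by simp [radial, h]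

variable
  [IsContMDiffRiemannianBundle (𝓡 (d + 1)) ∞ (EuclideanSpace ℝ (Fin (d + 1)))
    (fun x : M => TangentSpace (𝓡 (d + 1)) x)]

theorem contMDiffAt_norm {p : TangentBundle (𝓡 (d + 1)) M} (h : p.2 ≠ 0) :
    ContMDiffAt (𝓡 (d + 1)).tangent 𝓘(ℝ) ∞
      (fun q : TangentBundle (𝓡 (d + 1)) M => ‖q.2‖) p := by
  have h1 : ContMDiffAt (𝓡 (d + 1)).tangent 𝓘(ℝ) ∞
      (fun q : TangentBundle (𝓡 (d + 1)) M => inner ℝ q.2 q.2) p :=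
    ContMDiffAt.inner_bundle (E := fun x : M => TangentSpace (𝓡 (d + 1)) x)
      (b := fun q : TangentBundle (𝓡 (d + 1)) M => q.1)
      (v := fun q => q.2) (w := fun q => q.2) contMDiffAt_id contMDiffAt_id
  have h2 : (fun q : TangentBundle (𝓡 (d + 1)) M => ‖q.2‖) =
      Real.sqrt ∘ (fun q : TangentBundle (𝓡 (d + 1)) M => inner ℝ q.2 q.2) := by
    ext q; exact norm_eq_sqrt_real_inner _
  rw [h2]
  refine ContMDiffAt.comp p (ContDiffAt.contMDiffAt ?_) h1
  exact Real.contDiffAt_sqrt (by simpa using h)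

theorem contMDiffAt_smul {N : Type*} {F K : Type*} [NormedAddCommGroup F] [NormedSpace ℝ F] [TopologicalSpace K]
  {J : ModelWithCorners ℝ F K} [TopologicalSpace N] [ChartedSpace K N] {c : N → ℝ}
   {f : N → TangentBundle (𝓡 (d + 1)) M} {n : N} 
    (hc : ContMDiffAt J 𝓘(ℝ) ∞ c n) (hf : ContMDiffAt J (𝓡 (d + 1)).tangent ∞ f n) :
    ContMDiffAt J (𝓡 (d + 1)).tangent ∞
      (fun q => (⟨(f q).1, c q • (f q).2⟩ : TangentBundle (𝓡 (d + 1)) M)) n := by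
  rw [Bundle.contMDiffAt_totalSpace] at hf ⊢
  refine ⟨hf.1, (hc.smul hf.2).congr_of_eventuallyEq ?_⟩
  set e := trivializationAt (EuclideanSpace ℝ (Fin (d + 1))) (TangentSpace (𝓡 (d + 1))) (f n).1
  have := hf.1.continuousAt.preimage_mem_nhds (e.open_baseSet.mem_nhds (mem_baseSet_trivializationAt' _))
  filter_upwards [this] with q hq
  exact (e.linear ℝ hq).map_smul (c q) (f q).2

theorem contMDiffAt_radial_coe (w : SphereBundle d M) {p : TangentBundle (𝓡 (d + 1)) M} (h : p.2 ≠ 0) :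
    ContMDiffAt (𝓡 (d + 1)).tangent (𝓡 (d + 1)).tangent ∞
      (fun q => (radial w q).1) p := by
  have h1 := contMDiffAt_smul ((contMDiffAt_norm h).inv₀ (norm_ne_zero_iff.2 h)) contMDiffAt_id
  refine h1.congr_of_eventuallyEq ?_
  have := (contMDiffAt_norm h).continuousAt.eventually_ne (norm_ne_zero_iff.2 h)
  filter_upwards [this] with q hq
  exact coe_radial w (by simpa using hq)


theorem continuousAt_radial (w : SphereBundle d M) {p : TangentBundle (𝓡 (d + 1)) M} (h : p.2 ≠ 0) :
    ContinuousAt (radial w) p :=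
  Topology.IsInducing.subtypeVal.continuousAt_iff.2 (contMDiffAt_radial_coe w h).continuousAt

theorem continuousAt_toSphere {u : EuclideanSpace ℝ (Fin (d + 1))} (h : u ≠ 0) :
    ContinuousAt (toSphere : _ → fibSphere d) u := by
  refine Topology.IsInducing.subtypeVal.continuousAt_iff.2 ?_
  have : ContinuousAt (fun u : EuclideanSpace ℝ (Fin (d + 1)) => ‖u‖⁻¹ • u) u :=
    (continuousAt_id.norm.inv₀ (by simpa using h)).smul continuousAt_id
  refine this.congr ?_
  filter_upwards [isOpen_ne.mem_nhds h] with v hv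
  exact (coe_toSphere hv).symm

variable (d M) in
/-- The preferred trivialization of `TM` around `x`. -/
noncomputable abbrev triv (x : M) : Trivialization (EuclideanSpace ℝ (Fin (d + 1)))
    (π (EuclideanSpace ℝ (Fin (d + 1))) (TangentSpace (𝓡 (d + 1)) : M → Type _)) :=
  trivializationAt (EuclideanSpace ℝ (Fin (d + 1))) (TangentSpace (𝓡 (d + 1))) x

theorem triv_ne_zero (x : M) {p : TangentBundle (𝓡 (d + 1)) M} (hp : p.1 ∈ (triv d M x).baseSet)
    (h : p.2 ≠ 0) : (triv d M x p).2 ≠ 0 := by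
  have := ((triv d M x).linearEquivAt ℝ p.1 hp).map_ne_zero_iff.2 h
  simpa using this

theorem triv_symm_ne_zero (x : M) {y : M} (hy : y ∈ (triv d M x).baseSet)
    {u : EuclideanSpace ℝ (Fin (d + 1))}
    (h : u ≠ 0) : (triv d M x).symm y u ≠ 0 := by
  have := ((triv d M x).linearEquivAt ℝ y hy).symm.map_ne_zero_iff.2 h
  simpa using this

theorem snd_ne_zero (w : SphereBundle d M) : w.1.2 ≠ 0 := by
  intro h; have := w.2; simp [h] at this

theorem toSphere_smul {c : ℝ} (hc : 0 < c) {u : EuclideanSpace ℝ (Fin (d + 1))} :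
    (toSphere (c • u) : fibSphere d) = toSphere u := by
  by_cases hu : u = 0
  · simp [hu]
  · ext1
    rw [coe_toSphere (by simp [hu, hc.ne']), coe_toSphere hu, norm_smul, Real.norm_of_nonneg hc.le,
      smul_smul]
    congr 1
    field_simp

theorem toSphere_coe (s : fibSphere d) :
    (toSphere (s : EuclideanSpace ℝ (Fin (d + 1))) : fibSphere d) = s := by
  have h : ‖(s : EuclideanSpace ℝ (Fin (d + 1)))‖ = 1 := by simp
  ext1
  rw [coe_toSphere (by intro h0; simp [h0] at h), h]; simp

theorem radial_smul (w : SphereBundle d M) {c : ℝ} (hc : 0 < c) (p : TangentBundle (𝓡 (d + 1)) M) :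
    radial w ⟨p.1, c • p.2⟩ = radial w p := by
  by_cases hu : p.2 = 0
  · simp [radial, hu]
  · apply Subtype.ext
    have h1 : c • p.2 ≠ 0 := by simp [hu, hc.ne']
    rw [coe_radial w (p := ⟨p.1, c • p.2⟩) h1, coe_radial w hu]
    simp only [norm_smul, Real.norm_of_nonneg hc.le, smul_smul]
    congr 2
    field_simp

theorem radial_coe (w w' : SphereBundle d M) : radial w w'.1 = w' := by
  apply Subtype.ext
  rw [coe_radial w (snd_ne_zero w'), w'.2]; simp

/-- The local trivialization `SM ∣ U ≃ U × S^d` around `w`: read a unit tangent vector in the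
trivialization of `TM` and normalize it in the model space. -/
noncomputable def sphereTriv (w : SphereBundle d M) :
    OpenPartialHomeomorph (SphereBundle d M) (M × fibSphere d) where
  toFun w' := (w'.1.1, toSphere (triv d M w.1.1 w'.1).2)
  invFun q := radial w ⟨q.1, (triv d M w.1.1).symm q.1 q.2⟩
  source := {w' | w'.1.1 ∈ (triv d M w.1.1).baseSet}
  target := {q | q.1 ∈ (triv d M w.1.1).baseSet}
  map_source' _ h := h
  map_target' q hq := by
    have h0 : (triv d M w.1.1).symm q.1 (q.2 : EuclideanSpace ℝ (Fin (d + 1))) ≠ 0 :=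
      triv_symm_ne_zero _ hq (by
        intro h; have : ‖(q.2 : EuclideanSpace ℝ (Fin (d + 1)))‖ = 1 := by simp
        simp [h] at this)
    simpa [coe_radial w (p := ⟨q.1, (triv d M w.1.1).symm q.1 q.2⟩) h0] using hq
  left_inv' w' hw' := by
    have h0 := triv_ne_zero w.1.1 hw' (snd_ne_zero w')
    have h1 : (triv d M w.1.1).symm w'.1.1 (toSphere (triv d M w.1.1 w'.1).2 : fibSphere d)
        = ‖(triv d M w.1.1 w'.1).2‖⁻¹ • w'.1.2 := by
      rw [coe_toSphere h0]
      have := ((triv d M w.1.1).linearEquivAt ℝ w'.1.1 hw').symm.map_smul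
        (‖(triv d M w.1.1 w'.1).2‖⁻¹) (triv d M w.1.1 w'.1).2
      simp only [Trivialization.linearEquivAt_symm_apply] at this
      rw [this]
      congr 1
      exact (triv d M w.1.1).symm_apply_apply_mk hw' w'.1.2
    dsimp only
    rw [h1, radial_smul w (by simpa using h0), radial_coe]
  right_inv' q hq := by
    have h0 : (triv d M w.1.1).symm q.1 (q.2 : EuclideanSpace ℝ (Fin (d + 1))) ≠ 0 :=
      triv_symm_ne_zero _ hq (by
        intro h; have : ‖(q.2 : EuclideanSpace ℝ (Fin (d + 1)))‖ = 1 := by simp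
        simp [h] at this)
    rw [coe_radial w (p := ⟨q.1, (triv d M w.1.1).symm q.1 q.2⟩) h0]
    ext1
    · rfl
    · dsimp only
      have := ((triv d M w.1.1).linear ℝ hq).map_smul
        (‖(triv d M w.1.1).symm q.1 (q.2 : EuclideanSpace ℝ (Fin (d + 1)))‖⁻¹)
        ((triv d M w.1.1).symm q.1 q.2)
      rw [this, toSphere_smul (by simpa using h0), (triv d M w.1.1).apply_mk_symm hq]
      exact toSphere_coe q.2
  open_source := (triv d M w.1.1).open_baseSet.preimage
    ((FiberBundle.continuous_proj _ _).comp continuous_subtype_val)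
  open_target := (triv d M w.1.1).open_baseSet.preimage continuous_fst
  continuousOn_toFun := by
    intro w' hw'
    refine ContinuousAt.continuousWithinAt ?_
    have hc : ContinuousAt (fun w' : SphereBundle d M => w'.1) w' :=
      continuous_subtype_val.continuousAt
    refine ((FiberBundle.continuous_proj _ _).comp continuous_subtype_val).continuousAt.prodMk ?_
    have h0 := triv_ne_zero w.1.1 hw' (snd_ne_zero w')
    have h1 : ContinuousAt (triv d M w.1.1) w'.1 :=
      (triv d M w.1.1).continuousAt ((triv d M w.1.1).mem_source.2 hw')
    have h2 : ContinuousAt (fun w' : SphereBundle d M => (triv d M w.1.1 w'.1).2) w' :=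
      ContinuousAt.snd (ContinuousAt.comp (f := fun w' : SphereBundle d M => w'.1) h1 hc)
    exact ContinuousAt.comp (f := fun w' : SphereBundle d M => (triv d M w.1.1 w'.1).2)
      (continuousAt_toSphere h0) h2
  continuousOn_invFun := by
    intro q hq
    have h0 : (triv d M w.1.1).symm q.1 (q.2 : EuclideanSpace ℝ (Fin (d + 1))) ≠ 0 :=
      triv_symm_ne_zero _ hq (by
        intro h; have : ‖(q.2 : EuclideanSpace ℝ (Fin (d + 1)))‖ = 1 := by simp
        simp [h] at this)
    have h1 := (triv d M w.1.1).continuousOn_symm (q.1, q.2) ⟨hq, mem_univ _⟩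
    have h2 : ContinuousWithinAt (fun q : M × fibSphere d => (q.1, (q.2 : EuclideanSpace ℝ (Fin (d + 1)))))
       {q | q.1 ∈ (triv d M w.1.1).baseSet} q := by fun_prop
    have h3 := ContinuousWithinAt.comp (x := q)
      (f := fun q : M × fibSphere d => (q.1, (q.2 : EuclideanSpace ℝ (Fin (d + 1)))))
      h1 h2 (fun q hq => ⟨hq, mem_univ _⟩)
    exact ContinuousAt.comp_continuousWithinAt
      (f := fun q : M × fibSphere d => (⟨q.1, (triv d M w.1.1).symm q.1 q.2⟩ :
        TangentBundle (𝓡 (d + 1)) M)) (continuousAt_radial w h0) h3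

/-- Charts of `SM`: a local trivialization of `SM` followed by a product chart of `M × S^d`. -/
noncomputable instance : ChartedSpace (ModelProd (EuclideanSpace ℝ (Fin (d + 1))) (EuclideanSpace ℝ (Fin d)))
    (SphereBundle d M) where
  chartAt w := sphereTriv w ≫ₕ chartAt _ (sphereTriv w w)
  atlas := {c | ∃ w, c = sphereTriv w ≫ₕ chartAt _ (sphereTriv w w)}
  mem_chart_source w := by
    have : w ∈ (sphereTriv w).source := mem_baseSet_trivializationAt (EuclideanSpace ℝ (Fin (d + 1))) (TangentSpace (𝓡 (d + 1))) w.1.1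
    simp [this]
  chart_mem_atlas w := ⟨w, rfl⟩

theorem contMDiffAt_sphere {N : Type*} {F K : Type*} [NormedAddCommGroup F] [NormedSpace ℝ F]
    [TopologicalSpace K] {J : ModelWithCorners ℝ F K} [TopologicalSpace N] [ChartedSpace K N]
    {f : N → fibSphere d} {n : N}
    (hf : ContMDiffAt J 𝓘(ℝ, EuclideanSpace ℝ (Fin (d + 1))) ∞ (fun q => (f q).1) n) :
    ContMDiffAt J (𝓡 d) ∞ f n := by
  haveI := Fact.mk (@finrank_euclideanSpace_fin ℝ _ (d + 1))
  rw [contMDiffAt_iff_target]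
  refine ⟨Topology.IsInducing.subtypeVal.continuousAt_iff.2 hf.continuousAt, ?_⟩
  let v := f n
  let U : _ ≃ₗᵢ[ℝ] _ :=
    (OrthonormalBasis.fromOrthogonalSpanSingleton (𝕜 := ℝ) d (ne_zero_of_mem_unit_sphere (-v))).repr
  have h1 : ContDiffAt ℝ ∞ (stereoToFun (((-v : fibSphere d)) : EuclideanSpace ℝ (Fin (d + 1)))) v.1 := by
    refine (contDiffOn_stereoToFun.contDiffAt ((isOpen_ne.preimage (by fun_prop)).mem_nhds ?_))
    have h2 : inner ℝ v.1 v.1 = 1 := by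
      rw [real_inner_self_eq_norm_sq]; simp
    simp [inner_neg_left, h2]; norm_num
  have h2 := (U.contDiff (n := ∞)).contDiffAt.comp v.1 h1
  exact ContMDiffAt.comp (f := fun q => (f q).1) n (ContDiffAt.contMDiffAt h2) hf

theorem contMDiffAt_toSphere {u : EuclideanSpace ℝ (Fin (d + 1))} (h : u ≠ 0) :
    ContMDiffAt 𝓘(ℝ, EuclideanSpace ℝ (Fin (d + 1))) (𝓡 d) ∞ (toSphere : _ → fibSphere d) u := by
  apply contMDiffAt_sphere
  have : ContDiffAt ℝ ∞ (fun u : EuclideanSpace ℝ (Fin (d + 1)) => ‖u‖⁻¹ • u) u :=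
    ((contDiffAt_norm ℝ h).inv (by simpa using h)).smul contDiffAt_id
  refine this.contMDiffAt.congr_of_eventuallyEq ?_
  filter_upwards [isOpen_ne.mem_nhds h] with v hv
  exact coe_toSphere hv

theorem contMDiffAt_sphereTriv_aux (x : M) {p : TangentBundle (𝓡 (d + 1)) M}
    (hp : p.1 ∈ (triv d M x).baseSet) (h : p.2 ≠ 0) :
    ContMDiffAt (𝓡 (d + 1)).tangent ((𝓡 (d + 1)).prod (𝓡 d)) ∞
      (fun q : TangentBundle (𝓡 (d + 1)) M => (q.1, (toSphere (triv d M x q).2 : fibSphere d))) p := by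
  have h1 : ContMDiffAt (𝓡 (d + 1)).tangent ((𝓡 (d + 1)).prod 𝓘(ℝ, EuclideanSpace ℝ (Fin (d + 1)))) ∞
      (triv d M x) p :=
    (triv d M x).contMDiffOn.contMDiffAt
      ((triv d M x).open_source.mem_nhds ((triv d M x).mem_source.2 hp))
  refine (contMDiff_proj (TangentSpace (𝓡 (d + 1)) : M → Type _)).contMDiffAt.prodMk ?_
  exact ContMDiffAt.comp p (contMDiffAt_toSphere (triv_ne_zero x hp h)) (contMDiffAt_snd.comp p h1)

theorem sphere_ne_zero (s : fibSphere d) : s.1 ≠ 0 := by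
  intro h; have : ‖s.1‖ = 1 := by simp
  simp [h] at this

theorem contMDiffAt_sphereTriv_symm_aux (w : SphereBundle d M) {q : M × fibSphere d}
    (hq : q.1 ∈ (triv d M w.1.1).baseSet) :
    ContMDiffAt ((𝓡 (d + 1)).prod (𝓡 d)) (𝓡 (d + 1)).tangent ∞
      (fun q => ((sphereTriv w).symm q).1) q := by
  haveI := Fact.mk (@finrank_euclideanSpace_fin ℝ _ (d + 1))
  have h0 : (triv d M w.1.1).symm q.1 (q.2 : EuclideanSpace ℝ (Fin (d + 1))) ≠ 0 :=
      triv_symm_ne_zero _ hq (sphere_ne_zero _)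
  have h1 := ((triv d M w.1.1).contMDiffOn_symm (IB := 𝓡 (d + 1)) (n := ∞)).contMDiffAt
    (x := (q.1, q.2.1)) ((triv d M w.1.1).open_target.mem_nhds ((triv d M w.1.1).mem_target.2 hq))
  have h2 : ContMDiffAt ((𝓡 (d + 1)).prod (𝓡 d)) ((𝓡 (d + 1)).prod 𝓘(ℝ, EuclideanSpace ℝ (Fin (d + 1)))) ∞
    (fun q : M × fibSphere d => (q.1, q.2.1)) q :=
    contMDiffAt_fst.prodMk (contMDiff_coe_sphere.contMDiffAt.comp q contMDiffAt_snd)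
  have h3 := ContMDiffAt.comp (f := fun q : M × fibSphere d => (q.1, q.2.1)) q h1 h2
  have h4 : ContMDiffAt ((𝓡 (d + 1)).prod (𝓡 d)) (𝓡 (d + 1)).tangent ∞
    (fun q : M × fibSphere d => (⟨q.1, (triv d M w.1.1).symm q.1 q.2⟩ :
        TangentBundle (𝓡 (d + 1)) M)) q := by
    refine h3.congr_of_eventuallyEq ?_
    filter_upwards [((triv d M w.1.1).open_baseSet.preimage continuous_fst).mem_nhds hq] with q' hq'
    exact (triv d M w.1.1).mk_symm hq' _
  exact ContMDiffAt.comp (f := fun q : M × fibSphere d => (⟨q.1, (triv d M w.1.1).symm q.1 q.2⟩ :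
        TangentBundle (𝓡 (d + 1)) M)) q (contMDiffAt_radial_coe w h0) h4

/-- `SM` is a smooth manifold of dimension `(d + 1) + d`. -/
instance instIsManifoldSphereBundle :
    IsManifold ((𝓡 (d + 1)).prod (𝓡 d)) ∞ (SphereBundle d M) := by
  refine isManifold_of_contDiffOn _ _ _ ?_
  rintro _ _ ⟨w, rfl⟩ ⟨w', rfl⟩
  rw [← contMDiffOn_iff_contDiffOn]
  rintro z ⟨hz, -⟩
  refine ContMDiffAt.contMDiffWithinAt ?_
  set c := chartAt (ModelProd (EuclideanSpace ℝ (Fin (d + 1))) (EuclideanSpace ℝ (Fin d))) (sphereTriv w w)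
  set c' := chartAt (ModelProd (EuclideanSpace ℝ (Fin (d + 1))) (EuclideanSpace ℝ (Fin d))) (sphereTriv w' w')
  have hz1 : z ∈ c.target := by
    have := hz.1
    simp at this; exact this.1
  have hz2 : c.symm z ∈ (sphereTriv w).target := by
    have := hz.1
    simp at this; exact this.2
  have hz3 : (sphereTriv w).symm (c.symm z) ∈ (sphereTriv w').source := by
    have := hz.2
    simp at this; exact this.1
  have hz4 : sphereTriv w' ((sphereTriv w).symm (c.symm z)) ∈ c'.source := by
    have := hz.2
    simp at this; exact this.2
  have h1 : ContMDiffAt 𝓘(ℝ, EuclideanSpace ℝ (Fin (d + 1)) × EuclideanSpace ℝ (Fin d))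
      ((𝓡 (d + 1)).prod (𝓡 d)) ∞ (extChartAt ((𝓡 (d + 1)).prod (𝓡 d)) (sphereTriv w w)).symm z :=
    (contMDiffOn_extChartAt_symm (sphereTriv w w)).contMDiffAt
      (x := z) (by
        refine (isOpen_extChartAt_target _).mem_nhds ?_
        rw [extChartAt_target]; exact ⟨hz1, by simp⟩)
  have h2 := contMDiffAt_sphereTriv_symm_aux w hz2
  have h3 := contMDiffAt_sphereTriv_aux w'.1.1 hz3 (snd_ne_zero _)
  have h4 : ContMDiffAt ((𝓡 (d + 1)).prod (𝓡 d))
      𝓘(ℝ, EuclideanSpace ℝ (Fin (d + 1)) × EuclideanSpace ℝ (Fin d)) ∞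
      (extChartAt ((𝓡 (d + 1)).prod (𝓡 d)) (sphereTriv w' w')) _ :=
    contMDiffAt_extChartAt' hz4
  have h5 := h2.comp (f := (extChartAt ((𝓡 (d + 1)).prod (𝓡 d)) (sphereTriv w w)).symm) z h1
  have h6 := ContMDiffAt.comp (f := fun z => ((sphereTriv w).symm
    ((extChartAt ((𝓡 (d + 1)).prod (𝓡 d)) (sphereTriv w w)).symm z)).1) z h3 h5
  have h7 := ContMDiffAt.comp (f := fun z => sphereTriv w' ((sphereTriv w).symm
    ((extChartAt ((𝓡 (d + 1)).prod (𝓡 d)) (sphereTriv w w)).symm z))) z h4 h6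
  exact h7

/-- The inclusion `SM → TM` is smooth. -/
theorem contMDiff_coe : ContMDiff ((𝓡 (d + 1)).prod (𝓡 d)) (𝓡 (d + 1)).tangent ∞
    (fun w : SphereBundle d M => w.1) := by
  intro w
  have hw : w ∈ (sphereTriv w).source := mem_baseSet_trivializationAt (EuclideanSpace ℝ (Fin (d + 1))) (TangentSpace (𝓡 (d + 1))) w.1.1
  have h1 : ContMDiffAt ((𝓡 (d + 1)).prod (𝓡 d))
      𝓘(ℝ, EuclideanSpace ℝ (Fin (d + 1)) × EuclideanSpace ℝ (Fin d)) ∞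
      (extChartAt ((𝓡 (d + 1)).prod (𝓡 d)) w) w := contMDiffAt_extChartAt
  have h2 : ContMDiffAt 𝓘(ℝ, EuclideanSpace ℝ (Fin (d + 1)) × EuclideanSpace ℝ (Fin d))
      ((𝓡 (d + 1)).prod (𝓡 d)) ∞
      (extChartAt ((𝓡 (d + 1)).prod (𝓡 d)) (sphereTriv w w)).symm
      (extChartAt ((𝓡 (d + 1)).prod (𝓡 d)) w w) :=
    (contMDiffOn_extChartAt_symm (sphereTriv w w)).contMDiffAt
      ((isOpen_extChartAt_target _).mem_nhds (mem_extChartAt_target (sphereTriv w w)))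
  have h3 := h2.comp w h1
  have h4 : ContMDiffAt ((𝓡 (d + 1)).prod (𝓡 d)) ((𝓡 (d + 1)).prod (𝓡 d)) ∞ (sphereTriv w) w := by
    refine h3.congr_of_eventuallyEq ?_
    filter_upwards [(chartAt (ModelProd (EuclideanSpace ℝ (Fin (d + 1))) (EuclideanSpace ℝ (Fin d))) w).open_source.mem_nhds
      (mem_chart_source _ w)] with w' hw'
    have h5 : sphereTriv w w' ∈ (chartAt (ModelProd (EuclideanSpace ℝ (Fin (d + 1))) (EuclideanSpace ℝ (Fin d))) (sphereTriv w w)).source := hw'.2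
    exact ((chartAt _ (sphereTriv w w)).left_inv h5).symm
  have h5 := contMDiffAt_sphereTriv_symm_aux w (q := sphereTriv w w) hw
  refine (h5.comp w h4).congr_of_eventuallyEq ?_
  filter_upwards [(sphereTriv w).open_source.mem_nhds hw] with w' hw'
  exact congrArg Subtype.val ((sphereTriv w).left_inv hw').symm

/-- The radial retraction is smooth off the zero section. As it is a left inverse of the inclusion,
`SM` is an embedded submanifold of `TM`. -/
theorem contMDiffAt_radial (w : SphereBundle d M) {p : TangentBundle (𝓡 (d + 1)) M} (h : p.2 ≠ 0) :
    ContMDiffAt (𝓡 (d + 1)).tangent ((𝓡 (d + 1)).prod (𝓡 d)) ∞ (radial w) p := by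
  rw [contMDiffAt_iff_target]
  refine ⟨continuousAt_radial w h, ?_⟩
  set w' := radial w p
  have hw : w' ∈ (sphereTriv w').source := mem_baseSet_trivializationAt (EuclideanSpace ℝ (Fin (d + 1))) (TangentSpace (𝓡 (d + 1))) w'.1.1
  have h3 := ContMDiffAt.comp (f := fun q => (radial w q).1) p
    (contMDiffAt_sphereTriv_aux w'.1.1 hw (snd_ne_zero _)) (contMDiffAt_radial_coe w h)
  have h4 : ContMDiffAt ((𝓡 (d + 1)).prod (𝓡 d))
      𝓘(ℝ, EuclideanSpace ℝ (Fin (d + 1)) × EuclideanSpace ℝ (Fin d)) ∞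
      (extChartAt ((𝓡 (d + 1)).prod (𝓡 d)) (sphereTriv w' w')) (sphereTriv w' w') :=
    contMDiffAt_extChartAt
  exact ContMDiffAt.comp (f := fun q => sphereTriv w' (radial w q)) p h4 h3

/-- The differential of the radial retraction is the identity on `T_w (SM) ⊆ T_w (TM)`. -/
theorem mfderiv_radial_mfderiv_coe (w : SphereBundle d M)
    (ξ : TangentSpace ((𝓡 (d + 1)).prod (𝓡 d)) w) :
    mfderiv (𝓡 (d + 1)).tangent ((𝓡 (d + 1)).prod (𝓡 d)) (radial w) w.1
      (mfderiv ((𝓡 (d + 1)).prod (𝓡 d)) (𝓡 (d + 1)).tangent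
        (fun w : SphereBundle d M => w.1) w ξ) = ξ := by
  have h1 := (contMDiffAt_radial w (snd_ne_zero w)).mdifferentiableAt (by simp)
  have h2 := (contMDiff_coe (d := d) (M := M) w).mdifferentiableAt (by simp)
  have h3 := mfderiv_comp w h1 h2
  have h4 : radial w ∘ (fun w : SphereBundle d M => w.1) = id := by
    funext w'
    exact radial_coe w w'
  rw [h4, mfderiv_id] at h3
  exact (congrArg (fun L => L ξ) h3).symm

/-- The tangent vector of `SM` at `w = (x, v)` with block components `(y, u)` in the splitting
`T_w SM = T_x M ⊕ T_v (S_x M)`, for `y ∈ T_x M` and `u ∈ T_x M` orthogonal to `v`: the horizontal lift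
of `y` plus the vertical lift of `u`. This sum is a vector of `T_w (TM)` tangent to `SM`, and it is
viewed as a vector of `T_w (SM)` by the differential of the radial retraction, which is the identity
on `T_w (SM)`. -/
noncomputable def blockVector (w : SphereBundle d M) (y u : TangentSpace (𝓡 (d + 1)) w.1.1) :
    TangentSpace ((𝓡 (d + 1)).prod (𝓡 d)) w :=
  mfderiv (𝓡 (d + 1)).tangent ((𝓡 (d + 1)).prod (𝓡 d)) (radial w) w.1
    (horizontalLift w.1 y + verticalLift w.1 u)

/-- The vector field `V_A(v) = A v - ⟨v, A v⟩ v` on the unit sphere of `T_x M`. -/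
noncomputable def projField {x : M}
    (A : TangentSpace (𝓡 (d + 1)) x →L[ℝ] TangentSpace (𝓡 (d + 1)) x)
    (v : TangentSpace (𝓡 (d + 1)) x) : TangentSpace (𝓡 (d + 1)) x :=
  A v - (inner ℝ v (A v) : ℝ) • v

/-- The lift `X̃(x, v) = (X(x), V_{∇X(x)}(v))` of a vector field `X` on `M` to `SM`. -/
noncomputable def lift (X : (x : M) → TangentSpace (𝓡 (d + 1)) x) (w : SphereBundle d M) :
    TangentSpace ((𝓡 (d + 1)).prod (𝓡 d)) w :=
  blockVector w (X w.1.1) (projField (leviCivita (𝓡 (d + 1)) M X w.1.1) w.1.2)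

end SphereBundle

/-! ### Iterated brackets and the parabolic Hörmander condition -/

section Hormander

variable {E : Type*} [NormedAddCommGroup E] [NormedSpace ℝ E]
  {H : Type*} [TopologicalSpace H] (I : ModelWithCorners ℝ E H)
  {N : Type*} [TopologicalSpace N] [ChartedSpace H N] {r : ℕ}

/-- The collections `𝒳_k` of vector fields generated by `Z_0; Z_1, …, Z_r`: `𝒳_0 = {Z_j : j ≥ 1}` and
`𝒳_{k+1} = 𝒳_k ∪ {[Z_j, Y] : Y ∈ 𝒳_k, j ≥ 0}`. -/
noncomputable def brackets (Z : Fin (r + 1) → (x : N) → TangentSpace I x) : ℕ → Set ((x : N) → TangentSpace I x)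
  | 0 => {W | ∃ j : Fin (r + 1), j ≠ 0 ∧ W = Z j}
  | k + 1 => brackets Z k ∪ {W | ∃ j : Fin (r + 1), ∃ Y ∈ brackets Z k, W = mlieBracket I (Z j) Y}

/-- The parabolic Lie algebra `Lie(Z_0; Z_1, …, Z_r)`: the real linear span of `⋃ k, 𝒳_k`. -/
noncomputable def parabolicLie (Z : Fin (r + 1) → (x : N) → TangentSpace I x) :
    Submodule ℝ ((x : N) → TangentSpace I x) :=
  Submodule.span ℝ (⋃ k, brackets I Z k)

/-- The parabolic Hörmander condition: at every point the values of the fields of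
`Lie(Z_0; Z_1, …, Z_r)` fill the tangent space. -/
def ParabolicHormander (Z : Fin (r + 1) → (x : N) → TangentSpace I x) : Prop :=
  ∀ x : N, {v : TangentSpace I x | ∃ Y ∈ parabolicLie I Z, Y x = v} = Set.univ

variable [FiniteDimensional ℝ E] [IsManifold I ∞ N]
  [RiemannianBundle (fun x : N => TangentSpace I x)]
  [IsContMDiffRiemannianBundle I ∞ E (fun x : N => TangentSpace I x)]

/-- The set `𝔪_x(Z_0; Z_1, …, Z_r) = {M_Y(x) : Y ∈ Lie(Z_0; Z_1, …, Z_r), Y(x) = 0}` of traceless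
operators on `T_x N`. -/
def isotropy (Z : Fin (r + 1) → (x : N) → TangentSpace I x) (x : N) :
    Set (TangentSpace I x →L[ℝ] TangentSpace I x) :=
  {A | ∃ Y ∈ parabolicLie I Z, Y x = 0 ∧ A = tracelessPart Y x}

end Hormander

end ProjSpan

open ProjSpan

/-! On smooth fields the lift X ↦ X̃ is linear and commutes with Lie brackets. Hence the parabolic
Lie algebra of the lifts consists exactly of the lifts of the fields in the parabolic Lie algebra 𝓛
of the X_k (`mem_parabolicLie_lift_iff`). The rest is linear algebra at each w = (x, v). The linear
map Y ↦ (Y(x), V_{∇Y(x)}(v)) from 𝓛 to T_xM ⊕ v^⊥ is onto if and only if its first component is onto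
and its second component is already onto from the kernel {Y : Y(x) = 0} of the first. Multiples of
the identity do not contribute to V_A(v), so on that kernel ∇Y(x) may be replaced by its traceless
part, which gives 𝔪_x. That T_wSM really is T_xM ⊕ v^⊥ is the content of `blockVector_injective` and
`blockVector_surjective`.

The main point is compatibility with brackets (`mlieBracket_lift`). The lift X̃ is the image, under
the radial retraction of TM minus the zero section onto SM, of the complete lift of X, the field on
TM generated by the differential of the flow of X. In a chart the complete lift is (ξ, u) ↦ (V(ξ),
DV(ξ)u), and it commutes with brackets because second derivatives are symmetric
(`lieBracket_completeLift`). Two facts identify its image with X̃. Since the connection is torsion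
free, the connection terms of the horizontal lift of X(x) and of ∇_vX cancel, leaving DV(ξ)u
(`dchart_leviCivita_sub`). Since the retraction is constant on rays, its differential kills the
radial term ⟨v, ∇_vX⟩v (`dsphereParam_radial`). Both the complete lift and the retraction respect
fibre dilations, so the two fields are related at all nonzero vectors and not only at unit ones
(`lift_sphereParam`). Brackets of related fields are related (`mfderiv_mlieBracket_of_related`),
even though the retraction is not a local diffeomorphism. -/

open scoped Topology

set_option linter.unusedSectionVars false

/-! ### Related vector fields on normed spaces. -/

section RelatedFields

variable {E F : Type*} [NormedAddCommGroup E] [NormedSpace ℝ E] [NormedAddCommGroup F]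
  [NormedSpace ℝ F]

/-- On vector spaces, the Lie bracket respects `f`-related vector fields. -/
theorem fderiv_lieBracket_of_related {f : E → F} {V V' : E → E} {W W' : F → F} {x : E}
    (hf : ContDiffAt ℝ 2 f x) (hV : DifferentiableAt ℝ V x) (hV' : DifferentiableAt ℝ V' x)
    (hW : DifferentiableAt ℝ W (f x)) (hW' : DifferentiableAt ℝ W' (f x))
    (h : ∀ᶠ y in 𝓝 x, fderiv ℝ f y (V y) = W (f y))
    (h' : ∀ᶠ y in 𝓝 x, fderiv ℝ f y (V' y) = W' (f y)) :
    fderiv ℝ f x (lieBracket ℝ V V' x) = lieBracket ℝ W W' (f x) := by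
  have hfd : DifferentiableAt ℝ f x := hf.differentiableAt (by simp)
  have hfd2 : DifferentiableAt ℝ (fderiv ℝ f) x :=
    (hf.fderiv_right (m := 1) (by norm_num)).differentiableAt (by simp)
  -- Differentiate the relation Df(U) = Z ∘ f at x in the direction b. The second-derivative terms
  -- of the two instances used below cancel by symmetry of D²f.
  have key : ∀ {U : E → E} {Z : F → F}, DifferentiableAt ℝ U x → DifferentiableAt ℝ Z (f x) →
      (∀ᶠ y in 𝓝 x, fderiv ℝ f y (U y) = Z (f y)) → ∀ b,
      fderiv ℝ (fderiv ℝ f) x b (U x) + fderiv ℝ f x (fderiv ℝ U x b)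
        = fderiv ℝ Z (f x) (fderiv ℝ f x b) := by
    intro U Z hU hZ hUZ b
    have e1 := (hfd2.hasFDerivAt.clm_apply hU.hasFDerivAt).fderiv
    have e2 : fderiv ℝ (fun y => fderiv ℝ f y (U y)) x = fderiv ℝ (Z ∘ f) x :=
      Filter.EventuallyEq.fderiv_eq hUZ
    rw [fderiv_comp x hZ hfd, e1] at e2
    have := congrArg (fun L => L b) e2
    simpa [add_comm] using this
  have k1 := key hV' hW' h' (V x)
  have k2 := key hV hW h (V' x)
  have hs : fderiv ℝ (fderiv ℝ f) x (V x) (V' x) = fderiv ℝ (fderiv ℝ f) x (V' x) (V x) :=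
    hf.isSymmSndFDerivAt (by simp) (V x) (V' x)
  rw [h.self_of_nhds, hs] at k1
  rw [h'.self_of_nhds] at k2
  rw [lieBracket, lieBracket, map_sub, ← k1, ← k2]
  abel

end RelatedFields

/-! ### Vector fields and their brackets in the coordinates of a chart. -/

section Charts

variable {E : Type*} [NormedAddCommGroup E] [NormedSpace ℝ E]
  {H : Type*} [TopologicalSpace H] {I : ModelWithCorners ℝ E H}
  {M : Type*} [TopologicalSpace M] [ChartedSpace H M]

variable (I) in
/-- The differential at `y` of the extended chart at `x`, as a map into the model space. -/
noncomputable def dchart (x y : M) : TangentSpace I y →L[ℝ] E :=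
  mfderiv I 𝓘(ℝ, E) (extChartAt I x) y

variable (I) in
/-- The differential at `ξ` of the inverse of the extended chart at `x`. -/
noncomputable def dchartSymm (x : M) (ξ : E) : E →L[ℝ] TangentSpace I ((extChartAt I x).symm ξ) :=
  mfderiv 𝓘(ℝ, E) I (extChartAt I x).symm ξ

/-- The coordinate representation of a vector field in the chart at `x`. -/
noncomputable def chartField (x : M) (V : (y : M) → TangentSpace I y) (ξ : E) : E :=
  dchart I x ((extChartAt I x).symm ξ) (V ((extChartAt I x).symm ξ))

theorem chartField_extChartAt {x y : M} (hy : y ∈ (extChartAt I x).source)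
    (V : (y : M) → TangentSpace I y) :
    chartField x V (extChartAt I x y) = dchart I x y (V y) :=
  congrArg (fun z => dchart I x z (V z)) ((extChartAt I x).left_inv hy)

variable [IsManifold I ∞ M]

/-- The preferred trivialization of TM is the chart differential. This lets smoothness of sections,
which is stated through trivializations, pass to coordinate representations. -/
theorem continuousLinearMapAt_eq_dchart {x y : M} (hy : y ∈ (chartAt H x).source)
    (v : TangentSpace I y) :
    (trivializationAt E (TangentSpace I) x).continuousLinearMapAt ℝ y v = dchart I x y v := by
  rw [TangentBundle.continuousLinearMapAt_trivializationAt hy]; rfl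

theorem trivializationAt_snd_eq_dchart {x y : M} (hy : y ∈ (chartAt H x).source)
    (v : TangentSpace I y) :
    (trivializationAt E (TangentSpace I) x ⟨y, v⟩).2 = dchart I x y v := by
  rw [← continuousLinearMapAt_eq_dchart hy]
  exact (congrFun ((trivializationAt E (TangentSpace I) x).coe_linearMapAt_of_mem (R := ℝ)
    (by simpa using hy)) v).symm

theorem dchart_injective {x y : M} (hy : y ∈ (extChartAt I x).source) :
    Function.Injective (dchart I x y) :=
  (isInvertible_mfderiv_extChartAt hy).bijective.1

theorem dchart_surjective {x y : M} (hy : y ∈ (extChartAt I x).source) :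
    Function.Surjective (dchart I x y) :=
  (isInvertible_mfderiv_extChartAt hy).bijective.2

variable [I.Boundaryless]

theorem dchart_dchartSymm {x : M} {ξ : E} (hξ : ξ ∈ (extChartAt I x).target) (b : E) :
    dchart I x _ (dchartSymm I x ξ b) = b := by
  have := mfderiv_extChartAt_comp_mfderivWithin_extChartAt_symm hξ
  rw [I.range_eq_univ, mfderivWithin_univ] at this
  exact congrArg (fun L => L b) this

theorem dchartSymm_dchart {x : M} {ξ : E} (hξ : ξ ∈ (extChartAt I x).target)
    (v : TangentSpace I ((extChartAt I x).symm ξ)) :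
    dchartSymm I x ξ (dchart I x _ v) = v := by
  have := mfderivWithin_extChartAt_symm_comp_mfderiv_extChartAt hξ
  rw [I.range_eq_univ, mfderivWithin_univ] at this
  exact congrArg (fun L => L v) this

/-- The pullback inverts the differential of the inverse chart, while `chartField` applies the
differential of the chart; these are mutually inverse. -/
theorem mpullback_eq_chartField {x : M} {ξ : E} (hξ : ξ ∈ (extChartAt I x).target)
    (V : (y : M) → TangentSpace I y) :
    mpullback 𝓘(ℝ, E) I (extChartAt I x).symm V ξ = chartField x V ξ := by
  have i1 := isInvertible_mfderivWithin_extChartAt_symm hξ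
  rw [I.range_eq_univ, mfderivWithin_univ] at i1
  rw [mpullback_apply]
  exact i1.inverse_apply_eq.2 (dchartSymm_dchart hξ _).symm

/-- At the centre of its own chart the manifold bracket is by definition a coordinate bracket. Other
points of the chart domain need invariance under change of chart, which is obtained in
`dchart_mlieBracket`. -/
theorem dchart_mlieBracket_self (V W : (x : M) → TangentSpace I x) (x : M) :
    dchart I x x (mlieBracket I V W x) =
      lieBracket ℝ (chartField x V) (chartField x W) (extChartAt I x x) := by
  have h := (isOpen_extChartAt_target (I := I) x).mem_nhds (mem_extChartAt_target x)
  have e (V : (x : M) → TangentSpace I x) :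
      mpullbackWithin 𝓘(ℝ, E) I (extChartAt I x).symm V (range I)
        =ᶠ[𝓝 (extChartAt I x x)] chartField x V := by
    filter_upwards [h] with ξ hξ
    rw [I.range_eq_univ, mpullbackWithin_univ]
    exact mpullback_eq_chartField hξ V
  have h2 := Filter.EventuallyEq.lieBracket_vectorField_eq (𝕜 := ℝ) (e V) (e W)
  rw [← h2, ← mlieBracketWithin_univ, mlieBracketWithin_apply]
  have i1 := isInvertible_mfderiv_extChartAt (mem_extChartAt_source (I := I) x)
  refine (i1.inverse_apply_eq.1 rfl).symm.trans ?_
  rw [I.range_eq_univ, preimage_univ, inter_univ]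
  exact congrFun (lieBracketWithin_univ (𝕜 := ℝ) (E := E)) (extChartAt I x x)

theorem mdifferentiableAt_dchart {x y : M} (hy : y ∈ (chartAt H x).source)
    {V : (x : M) → TangentSpace I x} (hV : MDiffAt (T% V) y) :
    MDiffAt (fun z => dchart I x z (V z)) y := by
  have h1 := ((trivializationAt E (TangentSpace I) x).mdifferentiableAt_section_iff I V
    (by simpa using hy)).1 hV
  refine h1.congr_of_eventuallyEq ?_
  filter_upwards [(chartAt H x).open_source.mem_nhds hy] with z hz
  exact (trivializationAt_snd_eq_dchart hz _).symm

theorem differentiableAt_chartField {x y : M} (hy : y ∈ (chartAt H x).source)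
    {V : (x : M) → TangentSpace I x} (hV : MDiffAt (T% V) y) :
    DifferentiableAt ℝ (chartField x V) (extChartAt I x y) := by
  rw [← mdifferentiableAt_iff_differentiableAt]
  have h1 := mdifferentiableAt_dchart hy hV
  have hy' : y ∈ (extChartAt I x).source := by simpa using hy
  have h2 : MDifferentiableAt 𝓘(ℝ, E) I (extChartAt I x).symm (extChartAt I x y) :=
    ((contMDiffOn_extChartAt_symm (I := I) (n := 1) x).contMDiffAt
        ((isOpen_extChartAt_target x).mem_nhds
          ((extChartAt I x).map_source hy'))).mdifferentiableAt (by simp)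
  refine MDifferentiableAt.comp (extChartAt I x y) (g := fun z => dchart I x z (V z)) ?_ h2
  rw [(extChartAt I x).left_inv hy']
  exact h1

theorem contMDiffAt_dchart {x y : M} (hy : y ∈ (chartAt H x).source)
    {V : (x : M) → TangentSpace I x} (hV : CMDiffAt ∞ (T% V) y) :
    CMDiffAt ∞ (fun z => dchart I x z (V z)) y := by
  have h1 := ((trivializationAt E (TangentSpace I) x).contMDiffAt_section_iff 
    (by simpa using hy)).1 hV
  refine h1.congr_of_eventuallyEq ?_
  filter_upwards [(chartAt H x).open_source.mem_nhds hy] with z hz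
  exact (trivializationAt_snd_eq_dchart hz _).symm

theorem contDiffAt_chartField {x y : M} (hy : y ∈ (chartAt H x).source)
    {V : (x : M) → TangentSpace I x} (hV : CMDiffAt ∞ (T% V) y) :
    ContDiffAt ℝ ∞ (chartField x V) (extChartAt I x y) := by
  rw [← contMDiffAt_iff_contDiffAt]
  have h1 := contMDiffAt_dchart hy hV
  have hy' : y ∈ (extChartAt I x).source := by simpa using hy
  have h2 : ContMDiffAt 𝓘(ℝ, E) I ∞ (extChartAt I x).symm (extChartAt I x y) :=
    (contMDiffOn_extChartAt_symm (I := I) x).contMDiffAt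
        ((isOpen_extChartAt_target x).mem_nhds ((extChartAt I x).map_source hy'))
  refine ContMDiffAt.comp (extChartAt I x y) (g := fun z => dchart I x z (V z)) ?_ h2
  rw [(extChartAt I x).left_inv hy']
  exact h1

end Charts

/-! ### Related vector fields on manifolds. -/

section RelatedFields

variable {E F : Type*} [NormedAddCommGroup E] [NormedSpace ℝ E] [NormedAddCommGroup F]
  [NormedSpace ℝ F] {H H' : Type*} [TopologicalSpace H] [TopologicalSpace H']
  {I : ModelWithCorners ℝ E H} {J : ModelWithCorners ℝ F H'} [I.Boundaryless] [J.Boundaryless]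
  {M N : Type*} [TopologicalSpace M] [ChartedSpace H M] [TopologicalSpace N] [ChartedSpace H' N]
  [IsManifold I ∞ M] [IsManifold J ∞ N]

/-- The Lie bracket of vector fields on manifolds respects `f`-related vector fields. -/
theorem mfderiv_mlieBracket_of_related {f : M → N} {V V' : (x : M) → TangentSpace I x}
    {W W' : (y : N) → TangentSpace J y} {x : M} (hf : ContMDiffAt I J ∞ f x)
    (hV : MDiffAt (T% V) x) (hV' : MDiffAt (T% V') x)
    (hW : MDiffAt (T% W) (f x)) (hW' : MDiffAt (T% W') (f x))
    (h : ∀ᶠ y in 𝓝 x, mfderiv I J f y (V y) = W (f y))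
    (h' : ∀ᶠ y in 𝓝 x, mfderiv I J f y (V' y) = W' (f y)) :
    mfderiv I J f x (mlieBracket I V V' x) = mlieBracket J W W' (f x) := by
  have hx := mem_extChartAt_source (I := I) x
  have hfx := mem_extChartAt_source (I := J) (f x)
  let G : E → F := extChartAt J (f x) ∘ f ∘ (extChartAt I x).symm
  have hφs : ContMDiffAt 𝓘(ℝ, E) I ∞ (extChartAt I x).symm (extChartAt I x x) :=
    (contMDiffOn_extChartAt_symm x).contMDiffAt ((isOpen_extChartAt_target x).mem_nhds
      (mem_extChartAt_target x))
  have hinv : (extChartAt I x).symm (extChartAt I x x) = x := (extChartAt I x).left_inv hx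
  have hfφ : ContMDiffAt 𝓘(ℝ, E) J ∞ (f ∘ (extChartAt I x).symm) (extChartAt I x x) :=
    ContMDiffAt.comp _ (by rw [hinv]; exact hf) hφs
  have hGc : ContDiffAt ℝ ∞ G (extChartAt I x x) := by
    rw [← contMDiffAt_iff_contDiffAt]
    refine ContMDiffAt.comp _ ?_ hfφ
    simp only [Function.comp_apply, hinv]
    exact contMDiffAt_extChartAt
  have hGx : G (extChartAt I x x) = extChartAt J (f x) (f x) := by simp [G]
  -- The chain rule for the coordinate expression G of f is needed on a whole neighbourhood, since
  -- relatedness in coordinates must be differentiated.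
  have hdG : ∀ᶠ y in 𝓝 x, y ∈ (extChartAt I x).source ∧ f y ∈ (extChartAt J (f x)).source ∧
      ∀ v : TangentSpace I y,
        fderiv ℝ G (extChartAt I x y) (dchart I x y v) = dchart J (f x) (f y) (mfderiv I J f y v) := by
    have h0 := (isOpen_extChartAt_source (I := I) x).mem_nhds hx
    have h2 : ∀ᶠ y in 𝓝 x, f y ∈ (extChartAt J (f x)).source :=
      hf.continuousAt.eventually_mem ((isOpen_extChartAt_source (f x)).mem_nhds hfx)
    have h3 : ∀ᶠ y in 𝓝 x, ContMDiffAt I J 1 f y :=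
      (contMDiffAt_iff_contMDiffAt_nhds (by simp)).1 (hf.of_le (by norm_cast))
    have h4 : ∀ᶠ y in 𝓝 x, ContDiffAt ℝ 1 G (extChartAt I x y) :=
      (continuousAt_extChartAt x).eventually
        ((hGc.of_le (m := 1) (by norm_cast)).eventually (by simp))
    filter_upwards [eventually_mem_nhds_iff.2 h0, h2, h3, h4] with y m1 m2 m3 m4
    refine ⟨mem_of_mem_nhds m1, m2, fun v => ?_⟩
    have d1 : MDifferentiableAt I 𝓘(ℝ, E) (extChartAt I x) y :=
      mdifferentiableAt_extChartAt (by simpa using mem_of_mem_nhds m1)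
    have d2 := m3.mdifferentiableAt (by simp)
    have d3 : MDifferentiableAt J 𝓘(ℝ, F) (extChartAt J (f x)) (f y) :=
      mdifferentiableAt_extChartAt (by simpa using m2)
    have d4 : MDifferentiableAt 𝓘(ℝ, E) 𝓘(ℝ, F) G (extChartAt I x y) :=
      (m4.differentiableAt (by simp)).mdifferentiableAt
    have e : G ∘ extChartAt I x =ᶠ[𝓝 y] extChartAt J (f x) ∘ f := by
      filter_upwards [m1] with z hz
      simp only [G, Function.comp_apply, (extChartAt I x).left_inv hz]
    have e1 := e.mfderiv_eq (I := I) (I' := 𝓘(ℝ, F))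
    rw [mfderiv_comp y d4 d1, mfderiv_comp y d3 d2, mfderiv_eq_fderiv] at e1
    exact congrArg (fun L => L v) e1
  have hrel : ∀ {U : (x : M) → TangentSpace I x} {Z : (y : N) → TangentSpace J y},
      (∀ᶠ y in 𝓝 x, mfderiv I J f y (U y) = Z (f y)) → ∀ᶠ ξ in 𝓝 (extChartAt I x x),
        fderiv ℝ G ξ (chartField x U ξ) = chartField (f x) Z (G ξ) := by
    intro U Z hUZ
    have h1 : ∀ᶠ ξ in 𝓝 (extChartAt I x x), ξ ∈ (extChartAt I x).target :=
      (isOpen_extChartAt_target (I := I) x).mem_nhds (mem_extChartAt_target x)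
    have h2 := hφs.continuousAt.eventually (p := _) (by rw [hinv]; exact hUZ.and hdG)
    filter_upwards [h1, h2] with ξ m1 m2
    obtain ⟨m2, m3, m4, m5⟩ := m2
    have h6 := m5 (U _)
    rw [m2, (extChartAt I x).right_inv m1] at h6
    exact h6.trans (chartField_extChartAt m4 Z).symm
  have hxs : x ∈ (chartAt H x).source := mem_chart_source H x
  have hfxs : f x ∈ (chartAt H' (f x)).source := mem_chart_source H' (f x)
  have key := fderiv_lieBracket_of_related (hGc.of_le (m := 2) ENat.LEInfty.out)
    (differentiableAt_chartField hxs hV) (differentiableAt_chartField hxs hV')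
    (by rw [hGx]; exact differentiableAt_chartField hfxs hW)
    (by rw [hGx]; exact differentiableAt_chartField hfxs hW')
    (hrel h) (hrel h')
  rw [hGx, ← dchart_mlieBracket_self, ← dchart_mlieBracket_self] at key
  exact dchart_injective hfx ((hdG.self_of_nhds.2.2 _).symm.trans key)

/-- Together with `mlieBracket_vectorSpace`, this allows coordinate fields on a vector space to be
used as fields on a manifold in `mfderiv_mlieBracket_of_related`. -/
theorem mdifferentiableAt_vectorSpace {V : E → E} {x : E} (hV : DifferentiableAt ℝ V x) :
    MDifferentiableAt 𝓘(ℝ, E) 𝓘(ℝ, E).tangent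
      (fun ξ => (⟨ξ, V ξ⟩ : TangentBundle 𝓘(ℝ, E) E)) x := by
  refine ((trivializationAt E (TangentSpace 𝓘(ℝ, E)) x).mdifferentiableAt_section_iff
    𝓘(ℝ, E) V (mem_univ _)).2 ?_
  refine hV.mdifferentiableAt.congr_of_eventuallyEq (Filter.Eventually.of_forall fun ξ => ?_)
  exact congrArg Prod.snd (trivializationAt_model_space_apply (I := 𝓘(ℝ, E)) ⟨ξ, V ξ⟩ x)

theorem mlieBracket_vectorSpace (V W : E → E) (x : E) :
    mlieBracket 𝓘(ℝ, E) V W x = lieBracket ℝ V W x :=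
  (congrFun (mlieBracketWithin_eq_lieBracketWithin (𝕜 := ℝ) (V := V) (W := W) (s := univ)) x).trans
    (congrFun (lieBracketWithin_univ (𝕜 := ℝ) (E := E)) x)

/-- The Lie bracket of vector fields in the coordinates of any chart around the point. -/
theorem dchart_mlieBracket {V W : (x : M) → TangentSpace I x} {x y : M}
    (hy : y ∈ (chartAt H x).source) (hV : MDiffAt (T% V) y) (hW : MDiffAt (T% W) y) :
    dchart I x y (mlieBracket I V W y) =
      lieBracket ℝ (chartField x V) (chartField x W) (extChartAt I x y) := by
  -- A field is related to its coordinate representation by the chart itself, so the result on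
  -- related fields applies with f the chart.
  have hr (U : (x : M) → TangentSpace I x) : ∀ᶠ z in 𝓝 y,
      mfderiv I 𝓘(ℝ, E) (extChartAt I x) z (U z) = chartField x U (extChartAt I x z) := by
    filter_upwards [(chartAt H x).open_source.mem_nhds hy] with z hz
    exact (chartField_extChartAt (by simpa using hz) U).symm
  have := mfderiv_mlieBracket_of_related (f := extChartAt I x) (contMDiffAt_extChartAt' hy)
    hV hW (mdifferentiableAt_vectorSpace (differentiableAt_chartField hy hV))
    (mdifferentiableAt_vectorSpace (differentiableAt_chartField hy hW)) (hr V) (hr W)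
  exact this.trans (mlieBracket_vectorSpace _ _ _)

end RelatedFields

/-! ### Local parametrization of the tangent bundle. -/

section TangentParam

variable {E : Type*} [NormedAddCommGroup E] [NormedSpace ℝ E]
  {H : Type*} [TopologicalSpace H] {I : ModelWithCorners ℝ E H} [I.Boundaryless]
  {M : Type*} [TopologicalSpace M] [ChartedSpace H M]

variable (I) in
/-- The local parametrization of the tangent bundle by the chart at `x`. -/
noncomputable def tangentParam (x : M) (z : E × E) : TangentBundle I M :=
  ⟨(extChartAt I x).symm z.1, dchartSymm I x z.1 z.2⟩

variable [IsManifold I ∞ M]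

theorem tangentParam_dchart {x y : M} (hy : y ∈ (extChartAt I x).source) (v : TangentSpace I y) :
    tangentParam I x (extChartAt I x y, dchart I x y v) = ⟨y, v⟩ := by
  obtain ⟨ξ, hξ, rfl⟩ : ∃ ξ ∈ (extChartAt I x).target, (extChartAt I x).symm ξ = y :=
    ⟨_, (extChartAt I x).map_source hy, (extChartAt I x).left_inv hy⟩
  rw [(extChartAt I x).right_inv hξ]
  exact congrArg (Bundle.TotalSpace.mk _) (dchartSymm_dchart hξ v)

theorem symm_mem_source {x : M} {ξ : E} (hξ : ξ ∈ (extChartAt I x).target) :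
    (extChartAt I x).symm ξ ∈ (chartAt H x).source := by
  simpa using (extChartAt I x).map_target hξ

/-- Near z the parametrization is the inverse chart on the base followed by the inverse of the
trivialization of TM, and both are smooth. -/
theorem contMDiffAt_tangentParam {x : M} {z : E × E} (hz : z.1 ∈ (extChartAt I x).target) :
    ContMDiffAt 𝓘(ℝ, E × E) I.tangent ∞ (tangentParam I x) z := by
  let e := trivializationAt E (TangentSpace I : M → Type _) x
  have hb {ξ : E} (hξ : ξ ∈ (extChartAt I x).target) : (extChartAt I x).symm ξ ∈ e.baseSet := by
    simpa [e] using symm_mem_source hξ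
  have h1 := (e.contMDiffOn_symm (IB := I) (n := ∞)).contMDiffAt
    (x := ((extChartAt I x).symm z.1, z.2)) (e.open_target.mem_nhds (e.mem_target.2 (hb hz)))
  have h0 : ContMDiffAt 𝓘(ℝ, E) I ∞ (extChartAt I x).symm z.1 :=
    (contMDiffOn_extChartAt_symm x).contMDiffAt ((isOpen_extChartAt_target x).mem_nhds hz)
  have h2 : ContMDiffAt 𝓘(ℝ, E × E) (I.prod 𝓘(ℝ, E)) ∞
      (fun z : E × E => ((extChartAt I x).symm z.1, z.2)) z :=
    (ContMDiffAt.comp (g := (extChartAt I x).symm) (f := Prod.fst) z h0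
      contDiff_fst.contMDiff.contMDiffAt).prodMk contDiff_snd.contMDiff.contMDiffAt
  refine (ContMDiffAt.comp z h1 h2).congr_of_eventuallyEq ?_
  filter_upwards [((isOpen_extChartAt_target (I := I) x).preimage continuous_fst).mem_nhds hz]
    with z' hz'
  have h3 : e (tangentParam I x z') = ((extChartAt I x).symm z'.1, z'.2) :=
    Prod.ext rfl ((trivializationAt_snd_eq_dchart (symm_mem_source hz') _).trans
      (dchart_dchartSymm hz' z'.2))
  have h4 : tangentParam I x z' ∈ e.source := e.mem_source.2 (hb hz')
  exact (e.left_inv h4).symm.trans (congrArg e.toOpenPartialHomeomorph.symm h3)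

variable (I) in
/-- The differential of `tangentParam I x` at `z`. -/
noncomputable def dtangentParam (x : M) (z : E × E) : E × E →L[ℝ] E × E :=
  mfderiv 𝓘(ℝ, E × E) I.tangent (tangentParam I x) z

theorem hasMFDerivAt_tangentParam {x : M} {z : E × E} (hz : z.1 ∈ (extChartAt I x).target) :
    HasMFDerivAt 𝓘(ℝ, E × E) I.tangent (tangentParam I x) z (dtangentParam I x z) :=
  ((contMDiffAt_tangentParam hz).mdifferentiableAt (by simp)).hasMFDerivAt

end TangentParam

/-! ### Horizontal and vertical lifts in coordinates. -/

section Lifts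

variable {E : Type*} [NormedAddCommGroup E] [NormedSpace ℝ E] [FiniteDimensional ℝ E]
  {H : Type*} [TopologicalSpace H] {I : ModelWithCorners ℝ E H} [I.Boundaryless]
  {M : Type*} [TopologicalSpace M] [ChartedSpace H M] [IsManifold I ∞ M]

/-- In the parametrization a section is the graph ξ ↦ (ξ, σ(ξ)), so its velocity follows from the
chain rule. -/
theorem mfderiv_section_eq {x y : M} (hy : y ∈ (chartAt H x).source)
    {σ : (y : M) → TangentSpace I y} (hσ : MDiffAt (T% σ) y) (v : TangentSpace I y) :
    (mfderiv I I.tangent (fun y : M => (⟨y, σ y⟩ : TangentBundle I M)) y v : E × E) =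
      dtangentParam I x (extChartAt I x y, dchart I x y (σ y))
        (dchart I x y v, fderiv ℝ (chartField x σ) (extChartAt I x y) (dchart I x y v)) := by
  have hy' : y ∈ (extChartAt I x).source := by simpa using hy
  let g : E → E × E := fun ξ => (ξ, chartField x σ ξ)
  have h1 : HasMFDerivAt I 𝓘(ℝ, E) (extChartAt I x) y (dchart I x y) :=
    (mdifferentiableAt_extChartAt hy).hasMFDerivAt
  have hd := differentiableAt_chartField hy hσ
  have h2 : HasMFDerivAt 𝓘(ℝ, E) 𝓘(ℝ, E × E) g (extChartAt I x y)
      ((ContinuousLinearMap.id ℝ E).prod (fderiv ℝ (chartField x σ) (extChartAt I x y))) :=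
    ((hasFDerivAt_id (𝕜 := ℝ) _).prodMk hd.hasFDerivAt).hasMFDerivAt
  have h3 : HasMFDerivAt 𝓘(ℝ, E × E) I.tangent (tangentParam I x) (g (extChartAt I x y))
      (dtangentParam I x (g (extChartAt I x y))) :=
    hasMFDerivAt_tangentParam ((extChartAt I x).map_source hy')
  have e : (fun y : M => (⟨y, σ y⟩ : TangentBundle I M)) =ᶠ[𝓝 y]
      tangentParam I x ∘ (g ∘ extChartAt I x) := by
    filter_upwards [(isOpen_extChartAt_source (I := I) x).mem_nhds hy'] with z hz
    refine (tangentParam_dchart hz (σ z)).symm.trans ?_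
    simp only [Function.comp_apply, g, chartField_extChartAt hz]
  have e1 := ((h3.comp y (h2.comp y h1)).congr_of_eventuallyEq e).mfderiv
  rw [← chartField_extChartAt hy' σ]
  exact congrArg (fun L : E →L[ℝ] E × E => L v) e1

variable [RiemannianBundle (fun x : M => TangentSpace I x)]
  [IsContMDiffRiemannianBundle I ∞ E (fun x : M => TangentSpace I x)]

/-- The parametrization is linear on fibres, so the line v + tu comes from a line in the second
factor. -/
theorem verticalLift_eq {x y : M} (hy : y ∈ (chartAt H x).source) (v u : TangentSpace I y) :
    (verticalLift (⟨y, v⟩ : TangentBundle I M) u : E × E) =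
      dtangentParam I x (extChartAt I x y, dchart I x y v) (0, dchart I x y u) := by
  have hy' : y ∈ (extChartAt I x).source := by simpa using hy
  let g : ℝ → E × E := fun t => (extChartAt I x y, dchart I x y v + t • dchart I x y u)
  have hg0 : g 0 = (extChartAt I x y, dchart I x y v) := by simp [g]
  have h2 : HasMFDerivAt 𝓘(ℝ, ℝ) 𝓘(ℝ, E × E) g 0
      ((0 : ℝ →L[ℝ] E).prod ((ContinuousLinearMap.id ℝ ℝ).smulRight (dchart I x y u))) :=
    ((hasFDerivAt_const _ _).prodMk
      (((hasFDerivAt_id (0 : ℝ)).smul_const _).const_add _)).hasMFDerivAt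
  have h3 : HasMFDerivAt 𝓘(ℝ, E × E) I.tangent (tangentParam I x) (g 0)
      (dtangentParam I x (g 0)) :=
    hasMFDerivAt_tangentParam ((extChartAt I x).map_source hy')
  have e : (fun t : ℝ => (⟨y, v + t • u⟩ : TangentBundle I M)) = tangentParam I x ∘ g := by
    funext t
    refine (tangentParam_dchart hy' (v + t • u)).symm.trans ?_
    simp only [Function.comp_apply, g, map_add, map_smul]
  have e1 := (h3.comp 0 h2).mfderiv
  rw [← e] at e1
  rw [← hg0]
  refine (congrArg (fun L : ℝ →L[ℝ] E × E => L 1) e1).trans ?_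
  change dtangentParam I x (g 0) (0, (1 : ℝ) • dchart I x y u) = _
  rw [one_smul]

/-- The fibre component is minus the Christoffel term of b and v. It is kept as a difference for the
extension of v, so that Christoffel symbols never have to be introduced. -/
theorem horizontalLift_eq {x y : M} (hy : y ∈ (chartAt H x).source) (v b : TangentSpace I y) :
    (horizontalLift (⟨y, v⟩ : TangentBundle I M) b : E × E) =
      dtangentParam I x (extChartAt I x y, dchart I x y v)
        (dchart I x y b, fderiv ℝ (chartField x (extend E v)) (extChartAt I x y) (dchart I x y b)
          - dchart I x y (leviCivita I M (extend E v) y b)) := by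
  have h1 := mfderiv_section_eq hy (mdifferentiableAt_extend I E v) b
  have h2 := verticalLift_eq hy v (leviCivita I M (extend E v) y b)
  rw [extend_apply_self] at h1
  have h3 : ((dchart I x y b, fderiv ℝ (chartField x (extend E v)) (extChartAt I x y)
      (dchart I x y b) - dchart I x y (leviCivita I M (extend E v) y b)) : E × E) =
      (dchart I x y b, fderiv ℝ (chartField x (extend E v)) (extChartAt I x y) (dchart I x y b))
      - (0, dchart I x y (leviCivita I M (extend E v) y b)) := by simp
  rw [h3, map_sub, ← h1, ← h2]
  rfl

/-- In coordinates, the torsion-free condition gives the fibre component of the lift. -/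
theorem dchart_leviCivita_sub {x y : M} (hy : y ∈ (chartAt H x).source)
    {X : (y : M) → TangentSpace I y} (hX : MDiffAt (T% X) y) (v : TangentSpace I y) :
    fderiv ℝ (chartField x (extend E v)) (extChartAt I x y) (dchart I x y (X y))
      - dchart I x y (leviCivita I M (extend E v) y (X y))
      + dchart I x y (leviCivita I M X y v) =
    fderiv ℝ (chartField x X) (extChartAt I x y) (dchart I x y v) := by
  have hy' : y ∈ (extChartAt I x).source := by simpa using hy
  have hv := mdifferentiableAt_extend I E v
  -- For σ the extension of v, torsion-freeness gives ∇_vX − ∇_Xσ = [σ, X], and in coordinates this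
  -- bracket is DX(v) − Dσ(X).
  have h1 := (CovariantDerivative.torsion_eq_zero_iff _).1 (leviCivita_torsion (I := I) (M := M))
    hv hX
  rw [extend_apply_self] at h1
  have h2 := dchart_mlieBracket hy hv hX
  rw [← h1, map_sub, lieBracket, chartField_extChartAt hy', chartField_extChartAt hy',
    extend_apply_self] at h2
  rw [sub_eq_iff_eq_add.1 h2]
  abel

end Lifts

/-- Base points that agree only propositionally give different tangent space types. Reading the
derivative as a map of model spaces allows the base point to be changed. -/
theorem hasMFDerivAt_of_eq {E E' H H' M M' : Type*} [NormedAddCommGroup E] [NormedSpace ℝ E]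
    [NormedAddCommGroup E'] [NormedSpace ℝ E'] [TopologicalSpace H] [TopologicalSpace H']
    {I : ModelWithCorners ℝ E H} {I' : ModelWithCorners ℝ E' H'} [TopologicalSpace M]
    [ChartedSpace H M] [TopologicalSpace M'] [ChartedSpace H' M'] {f : M → M'} {x x' : M}
    (h : x = x') (hf : MDifferentiableAt I I' f x') :
    HasMFDerivAt I I' f x (show E →L[ℝ] E' from mfderiv I I' f x') := by
  subst h
  exact hf.hasMFDerivAt

/-! ### The lift as the image of the complete lift under radial retraction. -/

section SphereParam

variable {d : ℕ} {M : Type*} [TopologicalSpace M] [ChartedSpace (EuclideanSpace ℝ (Fin (d + 1))) M]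
  [RiemannianBundle (fun x : M => TangentSpace (𝓡 (d + 1)) x)] [IsManifold (𝓡 (d + 1)) ∞ M]

local notation "𝔼" => EuclideanSpace ℝ (Fin (d + 1))
local notation "𝔽" => EuclideanSpace ℝ (Fin d)

variable [IsContMDiffRiemannianBundle (𝓡 (d + 1)) ∞ (EuclideanSpace ℝ (Fin (d + 1)))
    (fun x : M => TangentSpace (𝓡 (d + 1)) x)]

/-- The local parametrization of the sphere bundle around `w`, defined off the zero section. -/
noncomputable def sphereParam (w : SphereBundle d M) (z : 𝔼 × 𝔼) : SphereBundle d M :=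
  radial w (tangentParam (𝓡 (d + 1)) w.1.1 z)

theorem radial_eq_radial (w w' : SphereBundle d M) {p : TangentBundle (𝓡 (d + 1)) M}
    (hp : p.2 ≠ 0) : radial w p = radial w' p :=
  Subtype.ext ((coe_radial w hp).trans (coe_radial w' hp).symm)

theorem tangentParam_snd_ne_zero {x : M} {z : 𝔼 × 𝔼}
    (hz : z.1 ∈ (extChartAt (𝓡 (d + 1)) x).target) (h : z.2 ≠ 0) :
    (tangentParam (𝓡 (d + 1)) x z).2 ≠ 0 := by
  intro h0
  apply h
  rw [← dchart_dchartSymm hz z.2]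
  exact (congrArg (dchart (𝓡 (d + 1)) x _) h0).trans (map_zero _)

theorem sphereParam_dchart (w w' : SphereBundle d M)
    (hy : w'.1.1 ∈ (extChartAt (𝓡 (d + 1)) w.1.1).source) :
    sphereParam w (extChartAt (𝓡 (d + 1)) w.1.1 w'.1.1,
      dchart (𝓡 (d + 1)) w.1.1 w'.1.1 w'.1.2) = w' := by
  rw [sphereParam, tangentParam_dchart hy]
  exact radial_coe w w'

theorem sphereParam_smul (w : SphereBundle d M) {c : ℝ} (hc : 0 < c) (ξ u : 𝔼) :
    sphereParam w (ξ, c • u) = sphereParam w (ξ, u) := by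
  refine Eq.trans ?_ (radial_smul w hc (tangentParam (𝓡 (d + 1)) w.1.1 (ξ, u)))
  exact congrArg (fun v => radial w ⟨_, v⟩) (map_smul (dchartSymm (𝓡 (d + 1)) w.1.1 ξ) c u)

/-- The domain of the local parametrization of the sphere bundle. -/
def paramDomain (w : SphereBundle d M) : Set (𝔼 × 𝔼) :=
  {z | z.1 ∈ (extChartAt (𝓡 (d + 1)) w.1.1).target ∧ z.2 ≠ 0}

theorem isOpen_paramDomain (w : SphereBundle d M) : IsOpen (paramDomain w) :=
  ((isOpen_extChartAt_target (I := 𝓡 (d + 1)) w.1.1).preimage continuous_fst).inter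
    (isOpen_ne.preimage continuous_snd)

theorem contMDiffAt_sphereParam (w : SphereBundle d M) {z : 𝔼 × 𝔼} (hz : z ∈ paramDomain w) :
    ContMDiffAt 𝓘(ℝ, 𝔼 × 𝔼) ((𝓡 (d + 1)).prod (𝓡 d)) ∞ (sphereParam w) z :=
  (contMDiffAt_radial w (tangentParam_snd_ne_zero hz.1 hz.2)).comp z
    (contMDiffAt_tangentParam hz.1)

/-- The differential of `sphereParam w` at `z`. -/
noncomputable def dsphereParam (w : SphereBundle d M) (z : 𝔼 × 𝔼) : 𝔼 × 𝔼 →L[ℝ] 𝔼 × 𝔽 :=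
  mfderiv 𝓘(ℝ, 𝔼 × 𝔼) ((𝓡 (d + 1)).prod (𝓡 d)) (sphereParam w) z

theorem hasMFDerivAt_sphereParam (w : SphereBundle d M) {z : 𝔼 × 𝔼} (hz : z ∈ paramDomain w) :
    HasMFDerivAt 𝓘(ℝ, 𝔼 × 𝔼) ((𝓡 (d + 1)).prod (𝓡 d)) (sphereParam w) z (dsphereParam w z) :=
  ((contMDiffAt_sphereParam w hz).mdifferentiableAt (by simp)).hasMFDerivAt

/-- Differentiate the invariance of the parametrization under positive fibre dilations. -/
theorem dsphereParam_smul (w : SphereBundle d M) {c : ℝ} (hc : 0 < c) {ξ u : 𝔼}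
    (hz : (ξ, u) ∈ paramDomain w) (a b : 𝔼) :
    dsphereParam w (ξ, c • u) (a, c • b) = dsphereParam w (ξ, u) (a, b) := by
  let S : 𝔼 × 𝔼 →L[ℝ] 𝔼 × 𝔼 := (ContinuousLinearMap.id ℝ 𝔼).prodMap (c • ContinuousLinearMap.id ℝ 𝔼)
  have h1 : HasMFDerivAt 𝓘(ℝ, 𝔼 × 𝔼) 𝓘(ℝ, 𝔼 × 𝔼) S (ξ, u) S := S.hasFDerivAt.hasMFDerivAt
  have h2 : HasMFDerivAt 𝓘(ℝ, 𝔼 × 𝔼) ((𝓡 (d + 1)).prod (𝓡 d)) (sphereParam w) (S (ξ, u))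
      (dsphereParam w (S (ξ, u))) :=
    hasMFDerivAt_sphereParam w ⟨hz.1, smul_ne_zero hc.ne' hz.2⟩
  have e : sphereParam w ∘ S = sphereParam w := by
    funext z
    exact sphereParam_smul w hc z.1 z.2
  have h3 := (h2.comp (ξ, u) h1).mfderiv
  rw [e] at h3
  exact (congrArg (fun L : 𝔼 × 𝔼 →L[ℝ] 𝔼 × 𝔽 => L (a, b)) h3).symm

/-- The parametrization is constant along the ray t ↦ (ξ, tu), t > 0. This is why the projection
term in V_A(v) is invisible upstairs. -/
theorem dsphereParam_radial (w : SphereBundle d M) {ξ u : 𝔼} (hz : (ξ, u) ∈ paramDomain w) :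
    dsphereParam w (ξ, u) (0, u) = 0 := by
  let g : ℝ → 𝔼 × 𝔼 := fun t => (ξ, t • u)
  have hg1 : g 1 = (ξ, u) := by simp [g]
  have h2 : HasMFDerivAt 𝓘(ℝ, ℝ) 𝓘(ℝ, 𝔼 × 𝔼) g 1
      ((0 : ℝ →L[ℝ] 𝔼).prod ((ContinuousLinearMap.id ℝ ℝ).smulRight u)) :=
    ((hasFDerivAt_const _ _).prodMk ((hasFDerivAt_id (1 : ℝ)).smul_const _)).hasMFDerivAt
  have h3 : HasMFDerivAt 𝓘(ℝ, 𝔼 × 𝔼) ((𝓡 (d + 1)).prod (𝓡 d)) (sphereParam w) (g 1)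
      (dsphereParam w (g 1)) := hasMFDerivAt_sphereParam w (by rwa [hg1])
  have e : sphereParam w ∘ g =ᶠ[𝓝 1] fun _ => sphereParam w (ξ, u) := by
    filter_upwards [Ioi_mem_nhds zero_lt_one] with t ht
    exact sphereParam_smul w ht ξ u
  have h4 := (h3.comp 1 h2).mfderiv
  rw [e.mfderiv_eq, mfderiv_const] at h4
  have h5 := congrArg (fun L : ℝ →L[ℝ] 𝔼 × 𝔽 => L 1) h4
  rw [← hg1]
  refine Eq.trans ?_ h5.symm
  change _ = dsphereParam w (g 1) (0, (1 : ℝ) • u)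
  rw [one_smul]

/-- The point of the parameter domain over a point of the sphere bundle. -/
noncomputable def sphereCoord (w w' : SphereBundle d M) : 𝔼 × 𝔼 :=
  (extChartAt (𝓡 (d + 1)) w.1.1 w'.1.1, dchart (𝓡 (d + 1)) w.1.1 w'.1.1 w'.1.2)

theorem sphereCoord_mem (w : SphereBundle d M) {w' : SphereBundle d M}
    (hw : w'.1.1 ∈ (chartAt 𝔼 w.1.1).source) : sphereCoord w w' ∈ paramDomain w := by
  have hy : w'.1.1 ∈ (extChartAt (𝓡 (d + 1)) w.1.1).source := by simpa using hw
  refine ⟨(extChartAt (𝓡 (d + 1)) w.1.1).map_source hy, fun h => snd_ne_zero w' ?_⟩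
  exact dchart_injective hy (h.trans (map_zero _).symm)

/-- `blockVector` uses the retraction based at w', the parametrization the one based at w. They
differ only on the zero section, so their differentials at a unit vector agree. -/
theorem dradial_dtangentParam (w : SphereBundle d M) {w' : SphereBundle d M}
    (hw : w'.1.1 ∈ (chartAt 𝔼 w.1.1).source) (a : 𝔼 × 𝔼) :
    (mfderiv (𝓡 (d + 1)).tangent ((𝓡 (d + 1)).prod (𝓡 d)) (radial w') w'.1
      (dtangentParam (𝓡 (d + 1)) w.1.1 (sphereCoord w w') a) : 𝔼 × 𝔽) =
    dsphereParam w (sphereCoord w w') a := by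
  have hy : w'.1.1 ∈ (extChartAt (𝓡 (d + 1)) w.1.1).source := by simpa using hw
  have hm := sphereCoord_mem w hw
  have h1 := hasMFDerivAt_tangentParam (I := 𝓡 (d + 1)) hm.1
  have h2 := hasMFDerivAt_of_eq (tangentParam_dchart hy w'.1.2)
    ((contMDiffAt_radial w' (snd_ne_zero w')).mdifferentiableAt (by simp))
  have e : sphereParam w =ᶠ[𝓝 (sphereCoord w w')] radial w' ∘ tangentParam (𝓡 (d + 1)) w.1.1 := by
    filter_upwards [(isOpen_paramDomain w).mem_nhds hm] with z hz
    exact radial_eq_radial w w' (tangentParam_snd_ne_zero hz.1 hz.2)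
  have h3 := ((h2.comp (sphereCoord w w') h1).congr_of_eventuallyEq e).mfderiv
  exact (congrArg (fun L : 𝔼 × 𝔼 →L[ℝ] 𝔼 × 𝔽 => L a) h3).symm

/-- The block vector in the coordinates of the parametrization. -/
theorem blockVector_eq (w : SphereBundle d M) {w' : SphereBundle d M}
    (hw : w'.1.1 ∈ (chartAt 𝔼 w.1.1).source) (b u : TangentSpace (𝓡 (d + 1)) w'.1.1) :
    (blockVector w' b u : 𝔼 × 𝔽) = dsphereParam w (sphereCoord w w')
      (dchart (𝓡 (d + 1)) w.1.1 w'.1.1 b,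
        fderiv ℝ (chartField w.1.1 (extend 𝔼 w'.1.2)) (extChartAt (𝓡 (d + 1)) w.1.1 w'.1.1)
          (dchart (𝓡 (d + 1)) w.1.1 w'.1.1 b)
        - dchart (𝓡 (d + 1)) w.1.1 w'.1.1 (leviCivita (𝓡 (d + 1)) M (extend 𝔼 w'.1.2) w'.1.1 b)
        + dchart (𝓡 (d + 1)) w.1.1 w'.1.1 u) := by
  have h1 := horizontalLift_eq hw w'.1.2 b
  have h2 := verticalLift_eq hw w'.1.2 u
  rw [← dradial_dtangentParam w hw]
  refine congrArg (fun a : 𝔼 × 𝔼 => (mfderiv (𝓡 (d + 1)).tangent ((𝓡 (d + 1)).prod (𝓡 d))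
    (radial w') w'.1 a : 𝔼 × 𝔽)) ?_
  refine (congrArg₂ (fun a b : 𝔼 × 𝔼 => a + b) h1 h2).trans ?_
  refine (map_add (dtangentParam (𝓡 (d + 1)) w.1.1 (sphereCoord w w')) _ _).symm.trans ?_
  rw [Prod.mk_add_mk, add_zero]

/-- The complete lift of a vector field to the tangent bundle, in coordinates. -/
noncomputable def completeLift {E : Type*} [NormedAddCommGroup E] [NormedSpace ℝ E] (V : E → E)
    (z : E × E) : E × E :=
  (V z.1, fderiv ℝ V z.1 z.2)

/-- The torsion-free identity turns the fibre component into DX(v) − cv with c = ⟨v, ∇_vX⟩. The term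
cv is radial and is killed by the differential. -/
theorem lift_eq_sphereCoord (w : SphereBundle d M) {w' : SphereBundle d M}
    (hw : w'.1.1 ∈ (chartAt 𝔼 w.1.1).source) {X : (x : M) → TangentSpace (𝓡 (d + 1)) x}
    (hX : MDifferentiableAt (𝓡 (d + 1)) (𝓡 (d + 1)).tangent
      (fun x => (⟨x, X x⟩ : TangentBundle (𝓡 (d + 1)) M)) w'.1.1) :
    (lift X w' : 𝔼 × 𝔽) =
      dsphereParam w (sphereCoord w w') (completeLift (chartField w.1.1 X) (sphereCoord w w')) := by
  have hy : w'.1.1 ∈ (extChartAt (𝓡 (d + 1)) w.1.1).source := by simpa using hw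
  refine (blockVector_eq w hw _ _).trans ?_
  have h1 := dchart_leviCivita_sub hw hX w'.1.2
  have h2 := dsphereParam_radial w (sphereCoord_mem w hw)
  rw [projField, map_sub, map_smul, ← add_sub_assoc, h1]
  set c : ℝ := inner ℝ w'.1.2 (leviCivita (𝓡 (d + 1)) M X w'.1.1 w'.1.2)
  have h3 : ((dchart (𝓡 (d + 1)) w.1.1 w'.1.1 (X w'.1.1),
      fderiv ℝ (chartField w.1.1 X) (extChartAt (𝓡 (d + 1)) w.1.1 w'.1.1)
        (dchart (𝓡 (d + 1)) w.1.1 w'.1.1 w'.1.2)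
      - c • dchart (𝓡 (d + 1)) w.1.1 w'.1.1 w'.1.2) : 𝔼 × 𝔼) =
      completeLift (chartField w.1.1 X) (sphereCoord w w')
        - c • ((0, dchart (𝓡 (d + 1)) w.1.1 w'.1.1 w'.1.2) : 𝔼 × 𝔼) := by
    refine Prod.ext ?_ ?_
    · simpa [completeLift, sphereCoord] using (chartField_extChartAt hy X).symm
    · simp [completeLift, sphereCoord]
  rw [h3, map_sub, map_smul]
  have h4 : dsphereParam w (sphereCoord w w')
      ((0, dchart (𝓡 (d + 1)) w.1.1 w'.1.1 w'.1.2) : 𝔼 × 𝔼) = 0 := h2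
  rw [h4, smul_zero, sub_zero]

/-- The lift of `X` is related to the complete lift of `X` by the parametrization. -/
theorem lift_sphereParam (w : SphereBundle d M) {z : 𝔼 × 𝔼} (hz : z ∈ paramDomain w)
    {X : (x : M) → TangentSpace (𝓡 (d + 1)) x}
    (hX : MDifferentiableAt (𝓡 (d + 1)) (𝓡 (d + 1)).tangent
      (fun x => (⟨x, X x⟩ : TangentBundle (𝓡 (d + 1)) M))
      ((extChartAt (𝓡 (d + 1)) w.1.1).symm z.1)) :
    (lift X (sphereParam w z) : 𝔼 × 𝔽) =
      dsphereParam w z (completeLift (chartField w.1.1 X) z) := by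
  obtain ⟨ξ, u⟩ := z
  have hne := tangentParam_snd_ne_zero hz.1 hz.2
  set p := tangentParam (𝓡 (d + 1)) w.1.1 (ξ, u) with hp
  have hc : 0 < ‖p.2‖⁻¹ := by simpa using hne
  have hw : ‖‖p.2‖⁻¹ • p.2‖ = 1 := by simp [norm_smul, hne]
  -- The formula is known at unit vectors. A general point of the domain is moved there by the
  -- dilation with factor 1/|p|, under which the fibre component of the complete lift scales
  -- linearly.
  let w' : SphereBundle d M := ⟨⟨p.1, ‖p.2‖⁻¹ • p.2⟩, hw⟩
  have hw' : sphereParam w (ξ, u) = w' := Subtype.ext (coe_radial w hne)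
  have hs : w'.1.1 ∈ (chartAt 𝔼 w.1.1).source := symm_mem_source hz.1
  have hcoord : sphereCoord w w' = (ξ, ‖p.2‖⁻¹ • u) := by
    refine Prod.ext ((extChartAt (𝓡 (d + 1)) w.1.1).right_inv hz.1) ?_
    refine (map_smul (dchart (𝓡 (d + 1)) w.1.1 _) _ p.2).trans ?_
    exact congrArg (fun a : 𝔼 => ‖p.2‖⁻¹ • a) (dchart_dchartSymm hz.1 u)
  refine (congrArg (fun w'' => (lift X w'' : 𝔼 × 𝔽)) hw').trans ?_
  rw [lift_eq_sphereCoord w hs hX, hcoord, ← dsphereParam_smul w hc hz]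
  simp [completeLift]

end SphereParam

/-! ### Complete lifts on a normed space and their brackets. -/

section CompleteLift

variable {E : Type*} [NormedAddCommGroup E] [NormedSpace ℝ E]

theorem hasFDerivAt_completeLift {V : E → E} {z : E × E} (hV : ContDiffAt ℝ 2 V z.1) :
    HasFDerivAt (completeLift V)
      (((fderiv ℝ V z.1).comp (ContinuousLinearMap.fst ℝ E E)).prod
        ((fderiv ℝ V z.1).comp (ContinuousLinearMap.snd ℝ E E) +
          ((fderiv ℝ (fderiv ℝ V) z.1).comp (ContinuousLinearMap.fst ℝ E E)).flip z.2)) z := by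
  have h1 : HasFDerivAt V (fderiv ℝ V z.1) z.1 := (hV.differentiableAt (by simp)).hasFDerivAt
  have h2 : HasFDerivAt (fderiv ℝ V) (fderiv ℝ (fderiv ℝ V) z.1) z.1 :=
    ((hV.fderiv_right (m := 1) (by norm_num)).differentiableAt (by simp)).hasFDerivAt
  exact (h1.comp z hasFDerivAt_fst).prodMk ((h2.comp z hasFDerivAt_fst).clm_apply hasFDerivAt_snd)

/-- Differentiating [V, W] in the direction u produces D²W(u, V) and D²V(u, W), whereas the bracket
of the complete lifts has these arguments in the other order. Symmetry of second derivatives matches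
them. -/
theorem lieBracket_completeLift {V W : E → E} {z : E × E} (hV : ContDiffAt ℝ 2 V z.1)
    (hW : ContDiffAt ℝ 2 W z.1) :
    lieBracket ℝ (completeLift V) (completeLift W) z = completeLift (lieBracket ℝ V W) z := by
  have hd {V : E → E} (hV : ContDiffAt ℝ 2 V z.1) : HasFDerivAt V (fderiv ℝ V z.1) z.1 :=
    (hV.differentiableAt (by simp)).hasFDerivAt
  have hd2 {V : E → E} (hV : ContDiffAt ℝ 2 V z.1) :
      HasFDerivAt (fderiv ℝ V) (fderiv ℝ (fderiv ℝ V) z.1) z.1 :=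
    ((hV.fderiv_right (m := 1) (by norm_num)).differentiableAt (by simp)).hasFDerivAt
  have h1 := (((hd2 hW).clm_apply (hd hV)).sub ((hd2 hV).clm_apply (hd hW))).fderiv
  have hs {V : E → E} (hV : ContDiffAt ℝ 2 V z.1) (a b : E) :
      fderiv ℝ (fderiv ℝ V) z.1 a b = fderiv ℝ (fderiv ℝ V) z.1 b a :=
    hV.isSymmSndFDerivAt (by simp) a b
  rw [lieBracket, (hasFDerivAt_completeLift hV).fderiv, (hasFDerivAt_completeLift hW).fderiv]
  refine Prod.ext rfl ?_
  have h2 : (completeLift (lieBracket ℝ V W) z).2 =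
      fderiv ℝ (fun ξ => fderiv ℝ W ξ (V ξ) - fderiv ℝ V ξ (W ξ)) z.1 z.2 := rfl
  rw [h2]
  refine Eq.trans ?_ (congrArg (fun L => L z.2) h1).symm
  simp [completeLift, hs hV z.2, hs hW z.2]

end CompleteLift

/-! ### Lifting commutes with Lie brackets. -/

section LiftBracket

variable {d : ℕ} {M : Type*} [TopologicalSpace M] [ChartedSpace (EuclideanSpace ℝ (Fin (d + 1))) M]
  [RiemannianBundle (fun x : M => TangentSpace (𝓡 (d + 1)) x)] [IsManifold (𝓡 (d + 1)) ∞ M]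
  [IsContMDiffRiemannianBundle (𝓡 (d + 1)) ∞ (EuclideanSpace ℝ (Fin (d + 1)))
    (fun x : M => TangentSpace (𝓡 (d + 1)) x)]

local notation "𝔼" => EuclideanSpace ℝ (Fin (d + 1))
local notation "𝔽" => EuclideanSpace ℝ (Fin d)

theorem mdifferentiableAt_sphereCoord (w : SphereBundle d M) :
    MDifferentiableAt ((𝓡 (d + 1)).prod (𝓡 d)) 𝓘(ℝ, 𝔼 × 𝔼) (sphereCoord w) w := by
  have h1 : MDifferentiableAt (𝓡 (d + 1)).tangent ((𝓡 (d + 1)).prod 𝓘(ℝ, 𝔼))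
      (triv d M w.1.1) w.1 :=
    ((triv d M w.1.1).contMDiffOn (n := 1)).contMDiffAt
      ((triv d M w.1.1).open_source.mem_nhds ((triv d M w.1.1).mem_source.2
        (mem_baseSet_trivializationAt 𝔼 (TangentSpace (𝓡 (d + 1))) w.1.1)))
      |>.mdifferentiableAt (by simp)
  have h2 : MDifferentiableAt ((𝓡 (d + 1)).prod (𝓡 d)) (𝓡 (d + 1)).tangent
      (fun w : SphereBundle d M => w.1) w := (contMDiff_coe w).mdifferentiableAt (by simp)
  have h3 : MDifferentiableAt ((𝓡 (d + 1)).prod (𝓡 d)) 𝓘(ℝ, 𝔼)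
      (fun w' : SphereBundle d M => (triv d M w.1.1 w'.1).2) w :=
    MDifferentiableAt.comp w mdifferentiableAt_snd (h1.comp w h2)
  have h4 : MDifferentiableAt ((𝓡 (d + 1)).prod (𝓡 d)) (𝓡 (d + 1))
      (fun w' : SphereBundle d M => w'.1.1) w :=
    MDifferentiableAt.comp w ((contMDiff_proj (n := 1)
      (TangentSpace (𝓡 (d + 1)) : M → Type _)).mdifferentiableAt (by simp)) h2
  have h5 : MDifferentiableAt ((𝓡 (d + 1)).prod (𝓡 d)) 𝓘(ℝ, 𝔼)
      (fun w' : SphereBundle d M => extChartAt (𝓡 (d + 1)) w.1.1 w'.1.1) w :=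
    MDifferentiableAt.comp w (mdifferentiableAt_extChartAt (mem_chart_source 𝔼 w.1.1)) h4
  refine (h5.prodMk_space h3).congr_of_eventuallyEq ?_
  filter_upwards [h4.continuousAt.eventually_mem
    ((chartAt 𝔼 w.1.1).open_source.mem_nhds (mem_chart_source 𝔼 w.1.1))] with w' hw'
  exact Prod.ext rfl (trivializationAt_snd_eq_dchart hw' w'.1.2).symm

/-- Regularity of the lift requires differentiating the differential of the parametrization. That
map is known to be smooth only off the zero section, so the argument goes through the tangent map
within the open domain. -/
theorem mdifferentiableAt_tangentMap_sphereParam (w : SphereBundle d M) {z : 𝔼 × 𝔼}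
    (hz : z ∈ paramDomain w) (a : 𝔼 × 𝔼) :
    MDifferentiableAt 𝓘(ℝ, 𝔼 × 𝔼).tangent ((𝓡 (d + 1)).prod (𝓡 d)).tangent
      (tangentMap 𝓘(ℝ, 𝔼 × 𝔼) ((𝓡 (d + 1)).prod (𝓡 d)) (sphereParam w))
      (⟨z, a⟩ : TangentBundle 𝓘(ℝ, 𝔼 × 𝔼) (𝔼 × 𝔼)) := by
  have ho := isOpen_paramDomain w
  have h1 : ContMDiffOn 𝓘(ℝ, 𝔼 × 𝔼) ((𝓡 (d + 1)).prod (𝓡 d)) 2 (sphereParam w) (paramDomain w) :=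
    fun z hz => ((contMDiffAt_sphereParam w hz).of_le ENat.LEInfty.out).contMDiffWithinAt
  have h2 := h1.contMDiffOn_tangentMapWithin (m := 1) (by norm_num) ho.uniqueMDiffOn
  have ho' : IsOpen (π (𝔼 × 𝔼) (TangentSpace 𝓘(ℝ, 𝔼 × 𝔼)) ⁻¹' paramDomain w) :=
    ho.preimage (FiberBundle.continuous_proj _ _)
  have h3 := (h2.contMDiffAt (x := ⟨z, a⟩) (ho'.mem_nhds hz)).mdifferentiableAt (by simp)
  refine h3.congr_of_eventuallyEq ?_
  filter_upwards [ho'.mem_nhds (show (⟨z, a⟩ : TangentBundle 𝓘(ℝ, 𝔼 × 𝔼) (𝔼 × 𝔼)) ∈ _ from hz)]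
    with p hp
  exact (tangentMapWithin_eq_tangentMap (ho.uniqueMDiffOn _ hp)
    ((contMDiffAt_sphereParam w hp).mdifferentiableAt (by simp))).symm

theorem contDiffAt_chartField_sphereCoord {X : (x : M) → TangentSpace (𝓡 (d + 1)) x}
    (hX : ContMDiff (𝓡 (d + 1)) (𝓡 (d + 1)).tangent ∞
      (fun x => (⟨x, X x⟩ : TangentBundle (𝓡 (d + 1)) M))) (w : SphereBundle d M) :
    ContDiffAt ℝ 2 (chartField w.1.1 X) (sphereCoord w w).1 :=
  (contDiffAt_chartField (mem_chart_source 𝔼 w.1.1) (hX w.1.1)).of_le ENat.LEInfty.out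

theorem sphereParam_sphereCoord_self (w : SphereBundle d M) : sphereParam w (sphereCoord w w) = w :=
  sphereParam_dchart w w (mem_extChartAt_source w.1.1)

/-- Near w the lift is the composite of `sphereCoord w`, a local section of the parametrization,
with the complete lift and then the tangent map of the parametrization. -/
theorem mdifferentiableAt_lift {X : (x : M) → TangentSpace (𝓡 (d + 1)) x}
    (hX : ContMDiff (𝓡 (d + 1)) (𝓡 (d + 1)).tangent ∞
      (fun x => (⟨x, X x⟩ : TangentBundle (𝓡 (d + 1)) M))) (w : SphereBundle d M) :
    MDifferentiableAt ((𝓡 (d + 1)).prod (𝓡 d)) ((𝓡 (d + 1)).prod (𝓡 d)).tangent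
      (fun w => (⟨w, lift X w⟩ : TangentBundle ((𝓡 (d + 1)).prod (𝓡 d)) (SphereBundle d M))) w := by
  have hm := sphereCoord_mem w (mem_chart_source 𝔼 w.1.1)
  have h1 := mdifferentiableAt_vectorSpace
    (hasFDerivAt_completeLift (contDiffAt_chartField_sphereCoord hX w)).differentiableAt
  have h2 := MDifferentiableAt.comp w h1 (mdifferentiableAt_sphereCoord w)
  have h3 := MDifferentiableAt.comp w (mdifferentiableAt_tangentMap_sphereParam w hm _) h2
  refine h3.congr_of_eventuallyEq ?_
  have h4 : ContinuousAt (fun w' : SphereBundle d M => w'.1.1) w :=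
    ((FiberBundle.continuous_proj _ _).comp continuous_subtype_val).continuousAt
  filter_upwards [h4.eventually_mem
    ((chartAt 𝔼 w.1.1).open_source.mem_nhds (mem_chart_source 𝔼 w.1.1))] with w' hw'
  have h5 := lift_eq_sphereCoord w hw' ((hX w'.1.1).mdifferentiableAt (by simp))
  have h6 : sphereParam w (sphereCoord w w') = w' :=
    sphereParam_dchart w w' (by simpa using hw')
  exact (congrArg (fun a : 𝔼 × 𝔽 => (⟨w', a⟩ :
      TangentBundle ((𝓡 (d + 1)).prod (𝓡 d)) (SphereBundle d M))) h5).trans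
    (congrArg (fun w'' => (⟨w'', dsphereParam w (sphereCoord w w')
      (completeLift (chartField w.1.1 X) (sphereCoord w w'))⟩ :
        TangentBundle ((𝓡 (d + 1)).prod (𝓡 d)) (SphereBundle d M))) h6.symm)

theorem contMDiff_mlieBracket {E H M : Type*} [NormedAddCommGroup E] [NormedSpace ℝ E]
    [CompleteSpace E] [TopologicalSpace H] {I : ModelWithCorners ℝ E H} [TopologicalSpace M]
    [ChartedSpace H M] [IsManifold I ∞ M] {X Y : (x : M) → TangentSpace I x}
    (hX : ContMDiff I I.tangent ∞ (fun x => (⟨x, X x⟩ : TangentBundle I M)))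
    (hY : ContMDiff I I.tangent ∞ (fun x => (⟨x, Y x⟩ : TangentBundle I M))) :
    ContMDiff I I.tangent ∞ (fun x => (⟨x, mlieBracket I X Y x⟩ : TangentBundle I M)) := by
  -- The bracket costs one derivative; this is harmless because ∞ + 1 = ∞.
  have : IsManifold I (((⊤ : ℕ∞) : WithTop ℕ∞) + 1) M := ‹IsManifold I ∞ M›
  have : IsManifold I (minSmoothness ℝ 2) M := by
    rw [minSmoothness_of_isRCLikeNormedField]
    infer_instance
  exact ContDiff.mlieBracket_vectorField (m := ⊤) (n := ⊤) hX hY (by simp)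

/-- Lifting to the sphere bundle commutes with Lie brackets. -/
theorem mlieBracket_lift {X Y : (x : M) → TangentSpace (𝓡 (d + 1)) x}
    (hX : ContMDiff (𝓡 (d + 1)) (𝓡 (d + 1)).tangent ∞
      (fun x => (⟨x, X x⟩ : TangentBundle (𝓡 (d + 1)) M)))
    (hY : ContMDiff (𝓡 (d + 1)) (𝓡 (d + 1)).tangent ∞
      (fun x => (⟨x, Y x⟩ : TangentBundle (𝓡 (d + 1)) M))) :
    mlieBracket ((𝓡 (d + 1)).prod (𝓡 d))
      (lift X : (w : SphereBundle d M) → TangentSpace ((𝓡 (d + 1)).prod (𝓡 d)) w) (lift Y) =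
      lift (mlieBracket (𝓡 (d + 1)) X Y) := by
  funext w
  have hm := sphereCoord_mem w (mem_chart_source 𝔼 w.1.1)
  have hψ := sphereParam_sphereCoord_self w
  have hcX := contDiffAt_chartField_sphereCoord hX w
  have hcY := contDiffAt_chartField_sphereCoord hY w
  have hrel {Z : (x : M) → TangentSpace (𝓡 (d + 1)) x}
      (hZ : ContMDiff (𝓡 (d + 1)) (𝓡 (d + 1)).tangent ∞
        (fun x => (⟨x, Z x⟩ : TangentBundle (𝓡 (d + 1)) M))) :
      ∀ᶠ z in 𝓝 (sphereCoord w w),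
        mfderiv 𝓘(ℝ, 𝔼 × 𝔼) ((𝓡 (d + 1)).prod (𝓡 d)) (sphereParam w) z
          (completeLift (chartField w.1.1 Z) z) = lift Z (sphereParam w z) := by
    filter_upwards [(isOpen_paramDomain w).mem_nhds hm] with z hz
    exact (lift_sphereParam w hz ((hZ _).mdifferentiableAt (by simp))).symm
  have key := mfderiv_mlieBracket_of_related (contMDiffAt_sphereParam w hm)
    (mdifferentiableAt_vectorSpace (hasFDerivAt_completeLift hcX).differentiableAt)
    (mdifferentiableAt_vectorSpace (hasFDerivAt_completeLift hcY).differentiableAt)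
    (mdifferentiableAt_lift hX _) (mdifferentiableAt_lift hY _) (hrel hX) (hrel hY)
  -- Equality near the point is needed, not just at it, because the complete lift involves the
  -- derivative of the field. The bracket formula is therefore used at points other than the centre
  -- of the chart.
  have hbr : chartField w.1.1 (mlieBracket (𝓡 (d + 1)) X Y) =ᶠ[𝓝 (sphereCoord w w).1]
      lieBracket ℝ (chartField w.1.1 X) (chartField w.1.1 Y) := by
    filter_upwards [(isOpen_extChartAt_target (I := 𝓡 (d + 1)) w.1.1).mem_nhds hm.1] with ξ hξ
    refine (dchart_mlieBracket (symm_mem_source hξ) ((hX _).mdifferentiableAt (by simp))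
      ((hY _).mdifferentiableAt (by simp))).trans ?_
    rw [(extChartAt (𝓡 (d + 1)) w.1.1).right_inv hξ]
  have e1 : (mlieBracket 𝓘(ℝ, 𝔼 × 𝔼) (completeLift (chartField w.1.1 X))
      (completeLift (chartField w.1.1 Y)) (sphereCoord w w) : 𝔼 × 𝔼) =
      completeLift (chartField w.1.1 (mlieBracket (𝓡 (d + 1)) X Y)) (sphereCoord w w) := by
    refine (mlieBracket_vectorSpace _ _ _).trans ((lieBracket_completeLift hcX hcY).trans ?_)
    rw [completeLift, completeLift, hbr.fderiv_eq, hbr.self_of_nhds]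
  have e2 := (hrel (contMDiff_mlieBracket hX hY)).self_of_nhds
  have e3 : mlieBracket ((𝓡 (d + 1)).prod (𝓡 d))
      (lift X : (w : SphereBundle d M) → TangentSpace ((𝓡 (d + 1)).prod (𝓡 d)) w) (lift Y)
        (sphereParam w (sphereCoord w w)) =
      lift (mlieBracket (𝓡 (d + 1)) X Y) (sphereParam w (sphereCoord w w)) :=
    key.symm.trans ((congrArg (dsphereParam w (sphereCoord w w)) e1).trans e2)
  rwa [hψ] at e3

end LiftBracket

/-! ### The splitting of the tangent space of the sphere bundle. -/

section Block

variable {d : ℕ} {M : Type*} [TopologicalSpace M] [ChartedSpace (EuclideanSpace ℝ (Fin (d + 1))) M]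
  [RiemannianBundle (fun x : M => TangentSpace (𝓡 (d + 1)) x)] [IsManifold (𝓡 (d + 1)) ∞ M]
  [IsContMDiffRiemannianBundle (𝓡 (d + 1)) ∞ (EuclideanSpace ℝ (Fin (d + 1)))
    (fun x : M => TangentSpace (𝓡 (d + 1)) x)]

local notation "𝔼" => EuclideanSpace ℝ (Fin (d + 1))
local notation "𝔽" => EuclideanSpace ℝ (Fin d)

/-- The parametrization has the local section `sphereCoord w`, so its differential has a right
inverse. -/
theorem dsphereParam_surjective (w : SphereBundle d M) :
    Function.Surjective (dsphereParam w (sphereCoord w w)) := by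
  have hm := sphereCoord_mem w (mem_chart_source 𝔼 w.1.1)
  have h1 := hasMFDerivAt_sphereParam w hm
  have h2 := (mdifferentiableAt_sphereCoord w).hasMFDerivAt
  have e : sphereParam w ∘ sphereCoord w =ᶠ[𝓝 w] id := by
    have h4 : ContinuousAt (fun w' : SphereBundle d M => w'.1.1) w :=
      ((FiberBundle.continuous_proj _ _).comp continuous_subtype_val).continuousAt
    filter_upwards [h4.eventually_mem
      ((chartAt 𝔼 w.1.1).open_source.mem_nhds (mem_chart_source 𝔼 w.1.1))] with w' hw'
    exact sphereParam_dchart w w' (by simpa using hw')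
  have h3 := ((h1.comp w h2).congr_of_eventuallyEq e.symm).mfderiv
  rw [mfderiv_id] at h3
  intro ζ
  exact ⟨_, (congrArg (fun L : 𝔼 × 𝔽 →L[ℝ] 𝔼 × 𝔽 => L ζ) h3).symm⟩

/-- A surjection from dimension 2(d + 1) onto dimension 2d + 1 has a one-dimensional kernel, and the
nonzero radial vector lies in it. -/
theorem eq_smul_of_dsphereParam_eq_zero (w : SphereBundle d M) {a : 𝔼 × 𝔼}
    (ha : dsphereParam w (sphereCoord w w) a = 0) :
    ∃ c : ℝ, a = c • ((0, (sphereCoord w w).2) : 𝔼 × 𝔼) := by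
  have hm := sphereCoord_mem w (mem_chart_source 𝔼 w.1.1)
  let L : 𝔼 × 𝔼 →ₗ[ℝ] 𝔼 × 𝔽 := (dsphereParam w (sphereCoord w w)).toLinearMap
  have h1 := L.finrank_range_add_finrank_ker
  have h2 : LinearMap.range L = ⊤ := LinearMap.range_eq_top.2 (dsphereParam_surjective w)
  rw [h2, finrank_top] at h1
  simp only [Module.finrank_prod, finrank_euclideanSpace_fin] at h1
  have h3 : Module.finrank ℝ (LinearMap.ker L) = 1 := by omega
  let k : LinearMap.ker L := ⟨(0, (sphereCoord w w).2), dsphereParam_radial w hm⟩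
  have hk : k ≠ 0 := fun h => hm.2 (congrArg (fun k : LinearMap.ker L => k.1.2) h)
  obtain ⟨c, hc⟩ := (finrank_eq_one_iff_of_nonzero' k hk).1 h3 ⟨a, ha⟩
  exact ⟨c, (congrArg Subtype.val hc).symm⟩

/-- The block vector at `w` as a linear map of its components. -/
noncomputable def blockMap (w : SphereBundle d M) :
    TangentSpace (𝓡 (d + 1)) w.1.1 × TangentSpace (𝓡 (d + 1)) w.1.1 →ₗ[ℝ] 𝔼 × 𝔽 :=
  let κ : TangentSpace (𝓡 (d + 1)) w.1.1 →ₗ[ℝ] 𝔼 := (dchart (𝓡 (d + 1)) w.1.1 w.1.1).toLinearMap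
  let p := LinearMap.fst ℝ (TangentSpace (𝓡 (d + 1)) w.1.1) (TangentSpace (𝓡 (d + 1)) w.1.1)
  let q := LinearMap.snd ℝ (TangentSpace (𝓡 (d + 1)) w.1.1) (TangentSpace (𝓡 (d + 1)) w.1.1)
  (dsphereParam w (sphereCoord w w)).toLinearMap ∘ₗ
    ((κ ∘ₗ p).prod ((fderiv ℝ (chartField w.1.1 (extend 𝔼 w.1.2))
        (extChartAt (𝓡 (d + 1)) w.1.1 w.1.1)).toLinearMap ∘ₗ κ ∘ₗ p
      - κ ∘ₗ (leviCivita (𝓡 (d + 1)) M (extend 𝔼 w.1.2) w.1.1).toLinearMap ∘ₗ p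
      + κ ∘ₗ q))

theorem blockVector_eq_blockMap (w : SphereBundle d M)
    (b u : TangentSpace (𝓡 (d + 1)) w.1.1) :
    (blockVector w b u : 𝔼 × 𝔽) = blockMap w (b, u) :=
  blockVector_eq w (mem_chart_source 𝔼 w.1.1) b u

theorem blockVector_add (w : SphereBundle d M) (b u b' u' : TangentSpace (𝓡 (d + 1)) w.1.1) :
    blockVector w (b + b') (u + u') = blockVector w b u + blockVector w b' u' :=
  (blockVector_eq_blockMap w _ _).trans ((map_add (blockMap w) (b, u) (b', u')).trans
    (congrArg₂ (fun a a' : 𝔼 × 𝔽 => a + a') (blockVector_eq_blockMap w b u)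
      (blockVector_eq_blockMap w b' u')).symm)

theorem blockVector_smul (w : SphereBundle d M) (c : ℝ) (b u : TangentSpace (𝓡 (d + 1)) w.1.1) :
    blockVector w (c • b) (c • u) = c • blockVector w b u :=
  (blockVector_eq_blockMap w _ _).trans ((map_smul (blockMap w) c (b, u)).trans
    (congrArg (fun a : 𝔼 × 𝔽 => c • a) (blockVector_eq_blockMap w b u)).symm)

/-- A vector in the kernel is radial, so b = 0 and u = cv; orthogonality of u to the unit vector v
forces c = 0. -/
theorem blockVector_eq_zero {w : SphereBundle d M} {b u : TangentSpace (𝓡 (d + 1)) w.1.1}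
    (hu : inner ℝ w.1.2 u = 0) (h : blockVector w b u = 0) : b = 0 ∧ u = 0 := by
  have hy := mem_extChartAt_source (I := 𝓡 (d + 1)) w.1.1
  obtain ⟨c, hc⟩ := eq_smul_of_dsphereParam_eq_zero w
    ((blockVector_eq w (mem_chart_source 𝔼 w.1.1) b u).symm.trans h)
  have hb : b = 0 := by
    refine dchart_injective hy ((congrArg Prod.fst hc).trans ?_)
    simp
  have h2 := congrArg Prod.snd hc
  refine ⟨hb, ?_⟩
  have hu' : u = c • w.1.2 := by
    apply dchart_injective hy
    subst hb
    simpa [sphereCoord] using h2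
  have hv : inner ℝ w.1.2 w.1.2 = 1 := by rw [real_inner_self_eq_norm_sq, w.2]; norm_num
  rw [hu', inner_smul_right, hv, mul_one] at hu
  rw [hu', hu, zero_smul]

theorem blockVector_injective {w : SphereBundle d M} {b u b' u' : TangentSpace (𝓡 (d + 1)) w.1.1}
    (hu : inner ℝ w.1.2 u = 0) (hu' : inner ℝ w.1.2 u' = 0)
    (h : blockVector w b u = blockVector w b' u') : b = b' ∧ u = u' := by
  have h1 : blockVector w (b - b') (u - u') = 0 := by
    have h2 := map_sub (blockMap w) (b, u) (b', u')
    refine (blockVector_eq_blockMap w _ _).trans (h2.trans (sub_eq_zero.2 ?_))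
    exact (blockVector_eq_blockMap w b u).symm.trans (h.trans (blockVector_eq_blockMap w b' u'))
  have := blockVector_eq_zero (by rw [inner_sub_right, hu, hu', sub_zero]) h1
  exact ⟨sub_eq_zero.1 this.1, sub_eq_zero.1 this.2⟩

theorem inner_projField (w : SphereBundle d M)
    (A : TangentSpace (𝓡 (d + 1)) w.1.1 →L[ℝ] TangentSpace (𝓡 (d + 1)) w.1.1) :
    inner ℝ w.1.2 (projField A w.1.2) = 0 := by
  have hv : inner ℝ w.1.2 w.1.2 = 1 := by rw [real_inner_self_eq_norm_sq, w.2]; norm_num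
  rw [projField, inner_sub_right, inner_smul_right, hv, mul_one, sub_self]

/-- Solve in coordinates for some pair (b, u). The component of u along v may then be removed, since
the block vector of (0, v) is zero. -/
theorem blockVector_surjective (w : SphereBundle d M)
    (ζ : TangentSpace ((𝓡 (d + 1)).prod (𝓡 d)) w) :
    ∃ b u : TangentSpace (𝓡 (d + 1)) w.1.1, inner ℝ w.1.2 u = 0 ∧ blockVector w b u = ζ := by
  have hy := mem_extChartAt_source (I := 𝓡 (d + 1)) w.1.1
  have hv : inner ℝ w.1.2 w.1.2 = 1 := by rw [real_inner_self_eq_norm_sq, w.2]; norm_num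
  obtain ⟨a, ha⟩ := dsphereParam_surjective w ζ
  obtain ⟨b, hb⟩ := dchart_surjective hy a.1
  obtain ⟨u, hu⟩ := dchart_surjective hy
    (a.2 - (fderiv ℝ (chartField w.1.1 (extend 𝔼 w.1.2)) (extChartAt (𝓡 (d + 1)) w.1.1 w.1.1) a.1
        - dchart (𝓡 (d + 1)) w.1.1 w.1.1
          (leviCivita (𝓡 (d + 1)) M (extend 𝔼 w.1.2) w.1.1 b)))
  have h1 : blockVector w b u = ζ := by
    refine (blockVector_eq w (mem_chart_source 𝔼 w.1.1) b u).trans (Eq.trans ?_ ha)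
    rw [hb, hu, add_sub_cancel]
  have h2 : blockVector w 0 w.1.2 = 0 := by
    refine (blockVector_eq w (mem_chart_source 𝔼 w.1.1) 0 w.1.2).trans ?_
    simp only [map_zero, sub_zero, zero_add]
    exact dsphereParam_radial w (sphereCoord_mem w (mem_chart_source 𝔼 w.1.1))
  refine ⟨b, u - (inner ℝ w.1.2 u : ℝ) • w.1.2, ?_, ?_⟩
  · rw [inner_sub_right, inner_smul_right, hv, mul_one, sub_self]
  · have h3 := blockVector_add w b u ((-(inner ℝ w.1.2 u : ℝ)) • (0 : TangentSpace (𝓡 (d + 1)) w.1.1))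
      ((-(inner ℝ w.1.2 u : ℝ)) • w.1.2)
    rw [blockVector_smul, h2, h1, smul_zero, smul_zero, add_zero, add_zero, neg_smul,
      ← sub_eq_add_neg] at h3
    exact h3

end Block

/-! ### Smoothness of the fields in the parabolic Lie algebra. -/

section SmoothFields

variable {E : Type*} [NormedAddCommGroup E] [NormedSpace ℝ E] [CompleteSpace E]
  {H : Type*} [TopologicalSpace H] {I : ModelWithCorners ℝ E H}
  {M : Type*} [TopologicalSpace M] [ChartedSpace H M] [IsManifold I ∞ M] {r : ℕ}

theorem contMDiff_of_mem_brackets {X : Fin (r + 1) → (x : M) → TangentSpace I x}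
    (hX : ∀ k, ContMDiff I I.tangent ∞ (fun x => (⟨x, X k x⟩ : TangentBundle I M))) (n : ℕ)
    {Y : (x : M) → TangentSpace I x} (hY : Y ∈ brackets I X n) :
    ContMDiff I I.tangent ∞ (fun x => (⟨x, Y x⟩ : TangentBundle I M)) := by
  induction n generalizing Y with
  | zero =>
    obtain ⟨j, -, rfl⟩ := hY
    exact hX j
  | succ n ih =>
    rcases hY with hY | ⟨j, Z, hZ, rfl⟩
    · exact ih hY
    · exact contMDiff_mlieBracket (hX j) (ih hZ)

theorem contMDiff_of_mem_parabolicLie {X : Fin (r + 1) → (x : M) → TangentSpace I x}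
    (hX : ∀ k, ContMDiff I I.tangent ∞ (fun x => (⟨x, X k x⟩ : TangentBundle I M)))
    {Y : (x : M) → TangentSpace I x} (hY : Y ∈ parabolicLie I X) :
    ContMDiff I I.tangent ∞ (fun x => (⟨x, Y x⟩ : TangentBundle I M)) := by
  induction hY using Submodule.span_induction with
  | mem Y hY =>
    obtain ⟨n, hn⟩ := mem_iUnion.1 hY
    exact contMDiff_of_mem_brackets hX n hn
  | zero =>
    -- The zero field is written as 0 • X_0, and X_0 always exists.
    have h := ContMDiff.const_smul_section (a := (0 : ℝ)) (hX 0)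
    rwa [zero_smul] at h
  | add Y Z _ _ hY hZ => exact ContMDiff.add_section hY hZ
  | smul c Y _ hY => exact ContMDiff.const_smul_section hY

end SmoothFields

/-! ### The parabolic Lie algebra of the lifts. -/

section Hormander

variable {d r : ℕ} {M : Type*} [TopologicalSpace M]
  [ChartedSpace (EuclideanSpace ℝ (Fin (d + 1))) M]
  [RiemannianBundle (fun x : M => TangentSpace (𝓡 (d + 1)) x)] [IsManifold (𝓡 (d + 1)) ∞ M]
  [IsContMDiffRiemannianBundle (𝓡 (d + 1)) ∞ (EuclideanSpace ℝ (Fin (d + 1)))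
    (fun x : M => TangentSpace (𝓡 (d + 1)) x)]

theorem projField_add {x : M}
    (A B : TangentSpace (𝓡 (d + 1)) x →L[ℝ] TangentSpace (𝓡 (d + 1)) x)
    (v : TangentSpace (𝓡 (d + 1)) x) : projField (A + B) v = projField A v + projField B v := by
  simp only [projField, add_apply, inner_add_right, add_smul]
  abel

theorem projField_smul {x : M} (c : ℝ)
    (A : TangentSpace (𝓡 (d + 1)) x →L[ℝ] TangentSpace (𝓡 (d + 1)) x)
    (v : TangentSpace (𝓡 (d + 1)) x) : projField (c • A) v = c • projField A v := by
  simp only [projField, smul_apply, inner_smul_right, smul_sub, smul_smul]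

/-- For a unit vector v, V_Id(v) = v − ⟨v, v⟩v = 0, so subtracting a multiple of the identity
changes nothing. -/
theorem projField_tracelessPart (X : (x : M) → TangentSpace (𝓡 (d + 1)) x) (w : SphereBundle d M) :
    projField (tracelessPart X w.1.1) w.1.2 =
      projField (leviCivita (𝓡 (d + 1)) M X w.1.1) w.1.2 := by
  have hv : inner ℝ w.1.2 w.1.2 = 1 := by rw [real_inner_self_eq_norm_sq, w.2]; norm_num
  simp only [projField, tracelessPart, sub_apply, smul_apply, ContinuousLinearMap.id_apply,
    inner_sub_right, inner_smul_right, hv, mul_one, sub_smul]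
  abel

/-- Smoothness is assumed because the connection is additive only on differentiable fields. For this
reason the lift is not packaged as a linear map on all fields. -/
theorem lift_add {X Y : (x : M) → TangentSpace (𝓡 (d + 1)) x}
    (hX : ContMDiff (𝓡 (d + 1)) (𝓡 (d + 1)).tangent ∞
      (fun x => (⟨x, X x⟩ : TangentBundle (𝓡 (d + 1)) M)))
    (hY : ContMDiff (𝓡 (d + 1)) (𝓡 (d + 1)).tangent ∞
      (fun x => (⟨x, Y x⟩ : TangentBundle (𝓡 (d + 1)) M))) :
    (lift (X + Y) : (w : SphereBundle d M) → TangentSpace ((𝓡 (d + 1)).prod (𝓡 d)) w) =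
      lift X + lift Y := by
  funext w
  have h := (leviCivita (𝓡 (d + 1)) M).isCovariantDerivativeOnUniv.add
    ((hX w.1.1).mdifferentiableAt (by simp)) ((hY w.1.1).mdifferentiableAt (by simp)) (mem_univ _)
  change lift (X + Y) w = lift X w + lift Y w
  rw [lift, lift, lift, h, projField_add, ← blockVector_add]
  rfl

theorem lift_smul (c : ℝ) {X : (x : M) → TangentSpace (𝓡 (d + 1)) x}
    (hX : ContMDiff (𝓡 (d + 1)) (𝓡 (d + 1)).tangent ∞
      (fun x => (⟨x, X x⟩ : TangentBundle (𝓡 (d + 1)) M))) :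
    (lift (c • X) : (w : SphereBundle d M) → TangentSpace ((𝓡 (d + 1)).prod (𝓡 d)) w) =
      c • lift X := by
  funext w
  have h := (leviCivita (𝓡 (d + 1)) M).isCovariantDerivativeOnUniv.smul_const c
    ((hX w.1.1).mdifferentiableAt (by simp)) (mem_univ _)
  change lift (c • X) w = c • lift X w
  rw [lift, lift, h, projField_smul, ← blockVector_smul]
  rfl

theorem brackets_lift {X : Fin (r + 1) → (x : M) → TangentSpace (𝓡 (d + 1)) x}
    (hX : ∀ k, ContMDiff (𝓡 (d + 1)) (𝓡 (d + 1)).tangent ∞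
      (fun x => (⟨x, X k x⟩ : TangentBundle (𝓡 (d + 1)) M))) (n : ℕ) :
    brackets ((𝓡 (d + 1)).prod (𝓡 d)) (fun k => (lift (X k) : (w : SphereBundle d M) →
      TangentSpace ((𝓡 (d + 1)).prod (𝓡 d)) w)) n = lift '' brackets (𝓡 (d + 1)) X n := by
  induction n with
  | zero =>
    ext W
    constructor
    · rintro ⟨j, hj, rfl⟩
      exact ⟨X j, ⟨j, hj, rfl⟩, rfl⟩
    · rintro ⟨_, ⟨j, hj, rfl⟩, rfl⟩
      exact ⟨j, hj, rfl⟩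
  | succ n ih =>
    rw [brackets, brackets, image_union, ih]
    congr 1
    ext W
    constructor
    · rintro ⟨j, _, ⟨Y, hY, rfl⟩, rfl⟩
      exact ⟨_, ⟨j, Y, hY, rfl⟩,
        (mlieBracket_lift (hX j) (contMDiff_of_mem_brackets hX n hY)).symm⟩
    · rintro ⟨_, ⟨j, Y, hY, rfl⟩, rfl⟩
      exact ⟨j, _, ⟨Y, hY, rfl⟩,
        (mlieBracket_lift (hX j) (contMDiff_of_mem_brackets hX n hY)).symm⟩

/-- The generating sets correspond under the lift by `brackets_lift`. Linearity on smooth fields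
carries this over to their spans. -/
theorem mem_parabolicLie_lift_iff {X : Fin (r + 1) → (x : M) → TangentSpace (𝓡 (d + 1)) x}
    (hX : ∀ k, ContMDiff (𝓡 (d + 1)) (𝓡 (d + 1)).tangent ∞
      (fun x => (⟨x, X k x⟩ : TangentBundle (𝓡 (d + 1)) M)))
    {W : (w : SphereBundle d M) → TangentSpace ((𝓡 (d + 1)).prod (𝓡 d)) w} :
    W ∈ parabolicLie ((𝓡 (d + 1)).prod (𝓡 d)) (fun k => (lift (X k) : (w : SphereBundle d M) →
      TangentSpace ((𝓡 (d + 1)).prod (𝓡 d)) w)) ↔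
      ∃ Y ∈ parabolicLie (𝓡 (d + 1)) X, lift Y = W := by
  have hs {Y : (x : M) → TangentSpace (𝓡 (d + 1)) x} (hY : Y ∈ parabolicLie (𝓡 (d + 1)) X) :=
    contMDiff_of_mem_parabolicLie hX hY
  have h0 : (lift (0 : (x : M) → TangentSpace (𝓡 (d + 1)) x) :
      (w : SphereBundle d M) → TangentSpace ((𝓡 (d + 1)).prod (𝓡 d)) w) = 0 := by
    have h := lift_smul (0 : ℝ) (hX 0)
    rwa [zero_smul, zero_smul] at h
  constructor
  · intro hW
    induction hW using Submodule.span_induction with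
    | mem W hW =>
      obtain ⟨n, hn⟩ := mem_iUnion.1 hW
      rw [brackets_lift hX] at hn
      obtain ⟨Y, hY, rfl⟩ := hn
      exact ⟨Y, Submodule.subset_span (mem_iUnion.2 ⟨n, hY⟩), rfl⟩
    | zero => exact ⟨0, zero_mem _, h0⟩
    | add W W' _ _ h h' =>
      obtain ⟨Y, hY, rfl⟩ := h
      obtain ⟨Y', hY', rfl⟩ := h'
      exact ⟨Y + Y', add_mem hY hY', lift_add (hs hY) (hs hY')⟩
    | smul c W _ h =>
      obtain ⟨Y, hY, rfl⟩ := h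
      exact ⟨c • Y, Submodule.smul_mem _ c hY, lift_smul c (hs hY)⟩
  · rintro ⟨Y, hY, rfl⟩
    induction hY using Submodule.span_induction with
    | mem Y hY =>
      obtain ⟨n, hn⟩ := mem_iUnion.1 hY
      refine Submodule.subset_span (mem_iUnion.2 ⟨n, ?_⟩)
      rw [brackets_lift hX]
      exact mem_image_of_mem _ hn
    | zero => rw [h0]; exact zero_mem _
    | add Y Z hY hZ h h' => rw [lift_add (hs hY) (hs hZ)]; exact add_mem h h'
    | smul c Y hY h => rw [lift_smul c (hs hY)]; exact Submodule.smul_mem _ c h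

end Hormander

/-! ### The equivalence, by linear algebra in each tangent space. -/

theorem proposition4p2 {d r : ℕ} {M : Type*} [TopologicalSpace M]
    [ChartedSpace (EuclideanSpace ℝ (Fin (d + 1))) M] [IsManifold (𝓡 (d + 1)) ∞ M]
    [RiemannianBundle (fun x : M => TangentSpace (𝓡 (d + 1)) x)]
    [IsContMDiffRiemannianBundle (𝓡 (d + 1)) ∞ (EuclideanSpace ℝ (Fin (d + 1)))
      (fun x : M => TangentSpace (𝓡 (d + 1)) x)]
    (X : Fin (r + 1) → (x : M) → TangentSpace (𝓡 (d + 1)) x)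
    (hX : ∀ k, ContMDiff (𝓡 (d + 1)) (𝓡 (d + 1)).tangent ∞
      (fun x => (⟨x, X k x⟩ : TangentBundle (𝓡 (d + 1)) M))) :
    ParabolicHormander ((𝓡 (d + 1)).prod (𝓡 d))
        (fun k => (lift (X k) : (w : SphereBundle d M) →
          TangentSpace ((𝓡 (d + 1)).prod (𝓡 d)) w)) ↔
      ParabolicHormander (𝓡 (d + 1)) X ∧
        ∀ w : SphereBundle d M,
          {u : TangentSpace (𝓡 (d + 1)) w.1.1 |
              ∃ A ∈ isotropy (𝓡 (d + 1)) X w.1.1, projField A w.1.2 = u} =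
            {u : TangentSpace (𝓡 (d + 1)) w.1.1 | inner ℝ w.1.2 u = 0} := by
  constructor
  · intro h
    -- Both components can be prescribed by one field of the Lie algebra. Below, u = 0 over any unit
    -- vector gives spanning on M, and b = 0 gives the condition on 𝔪_x.
    have key (w : SphereBundle d M) (b u : TangentSpace (𝓡 (d + 1)) w.1.1)
        (hu : inner ℝ w.1.2 u = 0) : ∃ Y ∈ parabolicLie (𝓡 (d + 1)) X, Y w.1.1 = b ∧
          projField (leviCivita (𝓡 (d + 1)) M Y w.1.1) w.1.2 = u := by
      obtain ⟨W, hW, hWw⟩ := eq_univ_iff_forall.1 (h w) (blockVector w b u)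
      obtain ⟨Y, hY, rfl⟩ := (mem_parabolicLie_lift_iff hX).1 hW
      exact ⟨Y, hY, blockVector_injective (inner_projField w _) hu hWw⟩
    refine ⟨fun x => eq_univ_iff_forall.2 fun b => ?_, fun w => Subset.antisymm ?_ ?_⟩
    -- The hypothesis lives on SM, so a unit vector over x is needed; one exists because the
    -- dimension d + 1 is positive.
    · have : Nontrivial (TangentSpace (𝓡 (d + 1)) x) :=
        inferInstanceAs (Nontrivial (EuclideanSpace ℝ (Fin (d + 1))))
      obtain ⟨v, hv⟩ := exists_norm_eq (TangentSpace (𝓡 (d + 1)) x) zero_le_one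
      obtain ⟨Y, hY, hYx, -⟩ := key ⟨⟨x, v⟩, hv⟩ b 0 (inner_zero_right _)
      exact ⟨Y, hY, hYx⟩
    · rintro u ⟨A, -, rfl⟩
      exact inner_projField w A
    · intro u hu
      obtain ⟨Y, hY, hY0, hYu⟩ := key w 0 u hu
      exact ⟨_, ⟨Y, hY, hY0, rfl⟩, (projField_tracelessPart Y w).trans hYu⟩
  · rintro ⟨h1, h2⟩ w
    refine eq_univ_iff_forall.2 fun ζ => ?_
    obtain ⟨b, u, hu, rfl⟩ := blockVector_surjective w ζ
    obtain ⟨Y, hY, rfl⟩ := eq_univ_iff_forall.1 (h1 w.1.1) b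
    have hu' : inner ℝ w.1.2 (u - projField (leviCivita (𝓡 (d + 1)) M Y w.1.1) w.1.2) = 0 := by
      rw [inner_sub_right, hu, inner_projField, sub_zero]
    -- Y attains the horizontal part b. Its vertical error is corrected by some Z that vanishes at x
    -- and so leaves b unchanged.
    obtain ⟨A, ⟨Z, hZ, hZ0, rfl⟩, hA⟩ := (h2 w).symm.subset hu'
    rw [projField_tracelessPart] at hA
    refine ⟨lift (Y + Z), (mem_parabolicLie_lift_iff hX).2 ⟨_, add_mem hY hZ, rfl⟩, ?_⟩
    rw [lift_add (contMDiff_of_mem_parabolicLie hX hY) (contMDiff_of_mem_parabolicLie hX hZ)]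
    change lift Y w + lift Z w = _
    rw [lift, lift, ← blockVector_add, hZ0, hA, add_zero, add_sub_cancel]
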